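/- Let $L>0$ and $\delta>0$ be fixed. For $k\in(0,1)$ put $k'=\sqrt{1-k^2}$, let $K(k)$ be the complete elliptic integral of the first kind, let $\mathrm{sn},\mathrm{cn},\mathrm{dn}$ be the Jacobi elliptic functions and $Z(\cdot\,;k)$ the Jacobi Zeta function, $Z(u;k)=\int_0^u\big(\mathrm{dn}^2(x;k)-E(k)/K(k)\big)\,dx$ for real $u$ (with $E(k)$ the complete elliptic integral of the second kind), continued meromorphically to complex $u$. Define $$\varphi_{k}(x)=\frac{2K(k)i}{L}\left[Z\!\left(\frac{2K(k)}{L}(x-i\delta);k\right)-Z\!\left(\frac{2K(k)}{L}(x+i\delta);k\right)\right],\qquad x\in\mathbb R,$$ $$c(k)=\frac1\delta-\frac{8\pi\delta K(k)}{L^2K(k')}-\frac{4K(k)}{L}\,Z\!\left(\frac{4\delta K(k)}{L};k'\right)-\frac{4K(k)}{L}\cdot\frac{\mathrm{cn}\!\left(\frac{4\delta K(k)}{L};k'\right)\mathrm{dn}\!\left(\frac{4\delta K(k)}{L};k'\right)}{\mathrm{sn}\!\left(\frac{4\delta K(k)}{L};k'\right)}.$$ Let $\mathcal M_\delta$ be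 the Fourier multiplier operator on $L$-periodic functions with symbol $\theta(n)=\frac{2\pi n}{L}\coth\!\left(\frac{2\pi n\delta}{L}\right)-\frac1\delta$ for $n\ne0$ and $\theta(0)=0$, let $H^n_{per}([0,L])$ be the periodic Sobolev space with norm $\|f\|^2=\sum_{m\in\mathbb Z}(1+m^2)^n|\widehat f(m)|^2$, and let $H_0=\{f\in L^2([0,L]):\int_0^Lf\,dx=0\}$. Then there is $k_1=k_1(L,\delta)\in(0,1)$ such that, for $k\in(0,1)$, one has $\frac{2\delta}{L}\frac{K(k)}{K(k')}<1$ if and only if $k<k_1$, and such that: 1. for every $n\in\mathbb N$, $k\in(0,k_1)\mapsto\varphi_k\in H^n_{per}([0,L])\cap H_0$ is a well-defined $C^\infty$ map; 2. for every $k\in(0,k_1)$ the function $\varphi_k$ is real-valued, $L$-periodic and even, the Fourier series of $\mathcal M_\delta\varphi_k$ converges absolutely at every point, and for all $x\in\mathbb R$ $$-c(k)\varphi_k(x)+\varphi_k(x)^2-\mathcal M_\delta\varphi_k(x)=A(k),\qquad A(k)=\frac1L\int_0^L\varphi_k(y)^2\,dy.$$ -/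

import Mathlib

open MeasureTheory Set AddCircle
open scoped ContDiff

noncomputable section

namespace ILW

/-! ### Jacobi elliptic functions of modulus `k ∈ (0,1)` -/

/-- Incomplete elliptic integral of the first kind, `F(φ;k) = ∫₀^φ dθ / √(1 - k² sin² θ)`. -/
def ellF (k φ : ℝ) : ℝ := ∫ θ in (0 : ℝ)..φ, 1 / √(1 - k ^ 2 * Real.sin θ ^ 2)

/-- Complete elliptic integral of the first kind. -/
def ellK (k : ℝ) : ℝ := ellF k (Real.pi / 2)

/-- Complete elliptic integral of the second kind. -/
def ellE (k : ℝ) : ℝ := ∫ θ in (0 : ℝ)..(Real.pi / 2), √(1 - k ^ 2 * Real.sin θ ^ 2)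

/-- Jacobi amplitude `am(u;k)`: the inverse of `φ ↦ F(φ;k)`, which for `k ∈ (0,1)` is an
increasing bijection of `ℝ`. -/
def am (u k : ℝ) : ℝ := Function.invFun (ellF k) u

/-- `sn(u;k)`. -/
def sn (u k : ℝ) : ℝ := Real.sin (am u k)

/-- `cn(u;k)`. -/
def cn (u k : ℝ) : ℝ := Real.cos (am u k)

/-- `dn(u;k)`. -/
def dn (u k : ℝ) : ℝ := √(1 - k ^ 2 * sn u k ^ 2)

/-- Jacobi Zeta function of a real argument. -/
def zetaReal (u k : ℝ) : ℝ := ∫ x in (0 : ℝ)..u, (dn x k ^ 2 - ellE k / ellK k)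

/-- The complementary modulus `k' = √(1 - k²)`. -/
def compl (k : ℝ) : ℝ := √(1 - k ^ 2)

/-- Jacobi Zeta function `Z(w;k)` of a complex argument `w = u + iv`, given by the classical
decomposition into real and imaginary parts (addition theorem together with Jacobi's imaginary
transformation). It is the meromorphic continuation of `zetaReal · k`; the denominator vanishes
exactly at the poles `w = 2mK(k) + (2n+1)iK(k')`. -/
def zeta (w : ℂ) (k : ℝ) : ℂ :=
  let u := w.re
  let v := w.im
  let k' := compl k
  let D := 1 - dn u k ^ 2 * sn v k' ^ 2
  ((zetaReal u k + k ^ 2 * sn u k * cn u k * dn u k * sn v k' ^ 2 / D : ℝ) : ℂ) +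
    Complex.I *
      ((dn u k ^ 2 * sn v k' * cn v k' * dn v k' / D - zetaReal v k'
        - Real.pi * v / (2 * ellK k * ellK k') : ℝ) : ℂ)

/-! ### The wave profile and the wave speed -/

/-- The profile
`φ(x) = (2K(k) i / L) [Z((2K(k)/L)(x - iδ); k) - Z((2K(k)/L)(x + iδ); k)]`. -/
def profile (L δ k x : ℝ) : ℂ :=
  2 * ellK k * Complex.I / L *
    (zeta (2 * ellK k / L * (x - Complex.I * δ)) k
      - zeta (2 * ellK k / L * (x + Complex.I * δ)) k)

/-- The wave speed `c(k)`. -/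
def speed (L δ k : ℝ) : ℝ :=
  1 / δ - 8 * Real.pi * δ * ellK k / (L ^ 2 * ellK (compl k))
    - 4 * ellK k / L * zetaReal (4 * δ * ellK k / L) (compl k)
    - 4 * ellK k / L *
      (cn (4 * δ * ellK k / L) (compl k) * dn (4 * δ * ellK k / L) (compl k)
        / sn (4 * δ * ellK k / L) (compl k))

/-- The quantity `v(L,δ,k) = (2δ/L) K(k)/K(k')`. -/
def vRatio (L δ k : ℝ) : ℝ := 2 * δ / L * (ellK k / ellK (compl k))

/-! ### The dispersion operator -/

/-- Fourier symbol of `M_δ = T_δ ∂ₓ - 1/δ` on `L`-periodic functions: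
`(2πn/L) coth(2πnδ/L) - 1/δ` for `n ≠ 0`, and `0` for `n = 0`. -/
def symbol (L δ : ℝ) (n : ℤ) : ℝ :=
  if n = 0 then 0
  else
    2 * Real.pi * n / L *
      (Real.cosh (2 * Real.pi * n * δ / L) / Real.sinh (2 * Real.pi * n * δ / L)) - 1 / δ

/-- `n`-th Fourier coefficient of an `L`-periodic function. -/
def coeff (L : ℝ) (f : ℝ → ℂ) (n : ℤ) : ℂ :=
  1 / L * ∫ x in (0 : ℝ)..L, f x * Complex.exp (-(2 * Real.pi * Complex.I * n * x / L))

/-- The `n`-th term of the Fourier series of `M_δ f` at the point `x`. -/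
def dispersionTerm (L δ : ℝ) (f : ℝ → ℂ) (x : ℝ) (n : ℤ) : ℂ :=
  symbol L δ n * coeff L f n * Complex.exp (2 * Real.pi * Complex.I * n * x / L)

/-- The Fourier multiplier operator `M_δ` (on functions for which the series converges). -/
def dispersion (L δ : ℝ) (f : ℝ → ℂ) (x : ℝ) : ℂ := ∑' n : ℤ, dispersionTerm L δ f x n

/-! ### Periodic Sobolev spaces -/

section Sobolev

variable (L : ℝ) [Fact (0 < L)] (n : ℕ)

/-- `L²` functions on the circle of length `L`, with the normalized measure `dx / L`. -/
abbrev PerL2 : Type := Lp ℂ 2 (haarAddCircle (T := L))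

/-- The weighted Fourier coefficients `(1 + m²)^(n/2) f̂(m)`. -/
def weightedCoeff : PerL2 L →ₗ[ℂ] (ℤ → ℂ) where
  toFun f m := ((√(1 + (m : ℝ) ^ 2) ^ n : ℝ) : ℂ) * fourierCoeff f m
  map_add' f g := by
    funext m
    simp only [← fourierBasis_repr, map_add, Pi.add_apply, lp.coeFn_add, mul_add]
  map_smul' a f := by
    funext m
    simp only [← fourierBasis_repr, map_smul, Pi.smul_apply, lp.coeFn_smul, smul_eq_mul,
      RingHom.id_apply]
    ring

/-- The underlying set of `H^n_per([0,L])`: those `f ∈ L²` with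
`∑ₘ (1 + m²)^n |f̂(m)|² < ∞`. -/
def sobolevSubmodule : Submodule ℂ (PerL2 L) where
  carrier := {f | Memℓp (weightedCoeff L n f) 2}
  zero_mem' := by simpa using zero_memℓp
  add_mem' {f g} hf hg := by
    simpa only [mem_ofPred_eq, map_add] using Memℓp.add hf hg
  smul_mem' a f hf := by
    simpa only [mem_ofPred_eq, map_smul] using Memℓp.const_smul hf a

/-- The periodic Sobolev space `H^n_per([0,L])`. -/
def HPer : Type := sobolevSubmodule L n

instance : AddCommGroup (HPer L n) := inferInstanceAs (AddCommGroup (sobolevSubmodule L n))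

instance : Module ℂ (HPer L n) := inferInstanceAs (Module ℂ (sobolevSubmodule L n))

/-- The inclusion `H^n_per([0,L]) → L²`. -/
def HPer.toL2 : HPer L n →ₗ[ℂ] PerL2 L := (sobolevSubmodule L n).subtype

/-- The linear embedding `f ↦ ((1 + m²)^(n/2) f̂(m))ₘ` of `H^n_per` into `ℓ²(ℤ)`. -/
def HPer.toSeq : HPer L n →ₗ[ℂ] lp (fun _ : ℤ => ℂ) 2 where
  toFun f := ⟨weightedCoeff L n (HPer.toL2 L n f), f.2⟩
  map_add' f g := by
    apply Subtype.ext
    simp only [map_add]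
    rfl
  map_smul' a f := by
    apply Subtype.ext
    simp only [map_smul]
    rfl

theorem HPer.toSeq_injective : Function.Injective (HPer.toSeq L n) := by
  intro f g h
  have h1 : weightedCoeff L n (HPer.toL2 L n f) = weightedCoeff L n (HPer.toL2 L n g) :=
    congrArg Subtype.val h
  apply Subtype.ext
  apply (fourierBasis (T := L)).repr.injective
  apply Subtype.ext
  funext m
  have h2 := congrFun h1 m
  have h3 : ((√(1 + (m : ℝ) ^ 2) ^ n : ℝ) : ℂ) ≠ 0 := by
    have : 0 < √(1 + (m : ℝ) ^ 2) := Real.sqrt_pos.mpr (by positivity)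
    exact_mod_cast (pow_pos this n).ne'
  have h4 := mul_left_cancel₀ h3 h2
  simp only [← fourierBasis_repr] at h4
  exact h4

/-- The Sobolev norm `‖f‖² = ∑ₘ (1 + m²)^n |f̂(m)|²`. -/
instance : NormedAddCommGroup (HPer L n) :=
  NormedAddCommGroup.induced _ _ (HPer.toSeq L n) (HPer.toSeq_injective L n)

instance : NormedSpace ℂ (HPer L n) := NormedSpace.induced ℂ _ _ (HPer.toSeq L n)

/-- The mean-zero space `H₀ = {f ∈ L² ; ∫₀^L f = 0}`. -/
def H0 : Submodule ℂ (PerL2 L) where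
  carrier := {f | ∫ x : AddCircle L, f x = 0}
  zero_mem' := by
    have h : ((0 : PerL2 L) : AddCircle L → ℂ) =ᵐ[haarAddCircle] 0 := Lp.coeFn_zero _ _ _
    rw [mem_ofPred_eq, volume_eq_smul_haarAddCircle, integral_smul_measure, integral_congr_ae h]
    simp
  add_mem' {f g} hf hg := by
    have hi : ∀ f : PerL2 L, Integrable f (volume : Measure (AddCircle L)) := fun f => by
      rw [volume_eq_smul_haarAddCircle]
      exact ((Lp.memLp f).integrable one_le_two).smul_measure ENNReal.ofReal_ne_top
    have h : ((f + g : PerL2 L) : AddCircle L → ℂ) =ᵐ[volume] f + g := by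
      rw [volume_eq_smul_haarAddCircle]
      exact (Lp.coeFn_add f g).filter_mono (Measure.ae_smul_measure_le _)
    rw [mem_ofPred_eq] at hf hg ⊢
    rw [integral_congr_ae h]
    simp only [Pi.add_apply]
    rw [integral_add (hi f) (hi g), hf, hg, add_zero]
  smul_mem' a f hf := by
    have h : ((a • f : PerL2 L) : AddCircle L → ℂ) =ᵐ[volume] a • (f : AddCircle L → ℂ) := by
      rw [volume_eq_smul_haarAddCircle]
      exact (Lp.coeFn_smul a f).filter_mono (Measure.ae_smul_measure_le _)
    rw [mem_ofPred_eq] at hf ⊢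
    rw [integral_congr_ae h]
    simp only [Pi.smul_apply]
    rw [integral_smul, hf, smul_zero]

/-- The space `H^n_per([0,L]) ∩ H₀`, with the norm of `H^n_per`. -/
abbrev HPerZero : Submodule ℂ (HPer L n) := (H0 L).comap (HPer.toL2 L n)

end Sobolev

end ILW

end

noncomputable section

namespace ILW

/-! ### The Jacobi elliptic functions of a real argument -/

section Jacobi

open Filter Topology

variable {k : ℝ}

/-! Write α = 2K/L. The two Zeta values in the profile are taken at conjugate points, so the real
parts cancel and φ_k(x) = 2α Im Z(αx + iαδ) (`profile_eq`). The condition 2δK/(LK') < 1 says that αδ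
lies below the height K' of the first pole. Everything follows from the function Im Z(u + iv) on |v|
< K'.

Fourier side. Im Z is harmonic, 2K-periodic in u and zero at v = 0, so its n-th Fourier integral in
u solves a'' = μ²a, a(0) = 0 with μ = nπ/K, and is a multiple of sinh(μv). The multiple is fixed by
letting v → K': there Im Z becomes π times a Dirac mass at u = 0 minus its mean
(`tendsto_periodIntegral_zetaIm`). Hence the integral is π sinh(μv)/sinh(μK') for n ≠ 0 and 0 for n
= 0. With d = 2πδ/L and ρ = πK'/K, the profile has coefficients (2π/L) sinh(nd)/sinh(nρ).
Multiplication by (2πn/L)coth(nd) turns sinh(nd) into cosh(nd), that is, Im Z into its v-derivative.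
So M_δφ_k is 2α² ∂_v Im Z minus φ_k/δ (`hasSum_dispersionTerm`).

Algebraic side. For fixed v, (Im Z)² - ½ ∂_v Im Z + C(v) Im Z does not depend on u
(`zetaIm_sq_identity`), where C(v) is the bracket that appears in c(k) through the duplication
formulas. Rescaled, this is the wave equation up to a constant; φ_k and ∂_v Im Z have mean zero, so
the constant is the mean of φ_k².

Smoothness. The coefficients depend on k only through ρ. Since d < ρ they decay exponentially, and
the weighted sequence is a holomorphic ℓ²-valued function of ρ on Re ρ > d
(`differentiableOn_curveSeq`); ρ is a smooth function of k. Finally K(k)/K(k') increases from 0 to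
∞, which gives k₁. -/

theorem one_sub_sq_mul_sin_sq_pos (hk : k ∈ Ioo (0 : ℝ) 1) (φ : ℝ) :
    0 < 1 - k ^ 2 * Real.sin φ ^ 2 := by
  have h1 := Real.sin_sq_le_one φ
  have h2 : k ^ 2 < 1 := by nlinarith [hk.1, hk.2]
  nlinarith [sq_nonneg k, sq_nonneg (Real.sin φ)]

theorem continuous_ellF_integrand (hk : k ∈ Ioo (0 : ℝ) 1) :
    Continuous fun θ : ℝ => 1 / √(1 - k ^ 2 * Real.sin θ ^ 2) := by
  refine Continuous.div continuous_const (by fun_prop) fun θ => ?_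
  exact (Real.sqrt_pos.mpr (one_sub_sq_mul_sin_sq_pos hk θ)).ne'

theorem hasDerivAt_ellF (hk : k ∈ Ioo (0 : ℝ) 1) (φ : ℝ) :
    HasDerivAt (ellF k) (1 / √(1 - k ^ 2 * Real.sin φ ^ 2)) φ :=
  intervalIntegral.integral_hasDerivAt_right
    ((continuous_ellF_integrand hk).intervalIntegrable _ _)
    ((continuous_ellF_integrand hk).stronglyMeasurableAtFilter _ _)
    (continuous_ellF_integrand hk).continuousAt

theorem ellF_zero : ellF k 0 = 0 := by simp [ellF]

theorem strictMono_ellF (hk : k ∈ Ioo (0 : ℝ) 1) : StrictMono (ellF k) := by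
  refine strictMono_of_deriv_pos fun φ => ?_
  rw [(hasDerivAt_ellF hk φ).deriv]
  have := Real.sqrt_pos.mpr (one_sub_sq_mul_sin_sq_pos hk φ)
  positivity

theorem continuous_ellF (hk : k ∈ Ioo (0 : ℝ) 1) : Continuous (ellF k) :=
  continuous_iff_continuousAt.mpr fun φ => (hasDerivAt_ellF hk φ).continuousAt

/-- The integrand of F is at least 1. This makes F(φ) tend to ±∞ with φ, which gives surjectivity.
-/
theorem monotone_ellF_sub_id (hk : k ∈ Ioo (0 : ℝ) 1) : Monotone fun φ => ellF k φ - φ := by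
  refine monotone_of_deriv_nonneg ?_ fun φ => ?_
  · exact fun φ => ((hasDerivAt_ellF hk φ).sub (hasDerivAt_id φ)).differentiableAt
  · have h := ((hasDerivAt_ellF hk φ).sub (hasDerivAt_id φ)).deriv
    rw [show (fun φ => ellF k φ - φ) = (ellF k - id) from rfl]
    rw [h]
    have h1 := Real.sqrt_pos.mpr (one_sub_sq_mul_sin_sq_pos hk φ)
    have h2 : √(1 - k ^ 2 * Real.sin φ ^ 2) ≤ 1 := by
      refine Real.sqrt_le_one.mpr ?_
      have : 0 ≤ k ^ 2 * Real.sin φ ^ 2 := by positivity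
      linarith
    have := (one_le_div h1).mpr h2
    linarith

theorem surjective_ellF (hk : k ∈ Ioo (0 : ℝ) 1) : Function.Surjective (ellF k) := by
  have hm := monotone_ellF_sub_id hk
  refine (continuous_ellF hk).surjective ?_ ?_
  · refine tendsto_atTop_mono' _ ?_ tendsto_id
    filter_upwards [eventually_ge_atTop 0] with φ hφ
    have := hm hφ
    simp only [ellF_zero] at this
    simp only [id]; linarith
  · refine tendsto_atBot_mono' _ ?_ tendsto_id
    filter_upwards [eventually_le_atBot 0] with φ hφ
    have := hm hφ
    simp only [ellF_zero] at this
    simp only [id]; linarith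

theorem ellF_am (hk : k ∈ Ioo (0 : ℝ) 1) (u : ℝ) : ellF k (am u k) = u :=
  Function.rightInverse_invFun (surjective_ellF hk) u

theorem am_ellF (hk : k ∈ Ioo (0 : ℝ) 1) (φ : ℝ) : am (ellF k φ) k = φ :=
  Function.leftInverse_invFun (strictMono_ellF hk).injective φ

theorem strictMono_am (hk : k ∈ Ioo (0 : ℝ) 1) : StrictMono fun u => am u k := by
  intro u v huv
  rw [← (strictMono_ellF hk).lt_iff_lt]
  simpa only [ellF_am hk] using huv

theorem continuous_am (hk : k ∈ Ioo (0 : ℝ) 1) : Continuous fun u => am u k :=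
  (strictMono_am hk).monotone.continuous_of_surjective fun φ => ⟨ellF k φ, am_ellF hk φ⟩

theorem sn_sq_add_cn_sq (u : ℝ) : sn u k ^ 2 + cn u k ^ 2 = 1 := Real.sin_sq_add_cos_sq _

theorem dn_pos (hk : k ∈ Ioo (0 : ℝ) 1) (u : ℝ) : 0 < dn u k :=
  Real.sqrt_pos.mpr (one_sub_sq_mul_sin_sq_pos hk _)

theorem dn_sq (hk : k ∈ Ioo (0 : ℝ) 1) (u : ℝ) : dn u k ^ 2 = 1 - k ^ 2 * sn u k ^ 2 :=
  Real.sq_sqrt (one_sub_sq_mul_sin_sq_pos hk _).le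

theorem dn_le_one (u : ℝ) : dn u k ≤ 1 := by
  refine Real.sqrt_le_one.mpr ?_
  have : 0 ≤ k ^ 2 * sn u k ^ 2 := by positivity
  linarith

theorem hasDerivAt_am (hk : k ∈ Ioo (0 : ℝ) 1) (u : ℝ) :
    HasDerivAt (fun u => am u k) (dn u k) u := by
  have h := HasDerivAt.of_local_left_inverse (f := ellF k) (g := fun u => am u k) (a := u)
    (continuous_am hk).continuousAt (hasDerivAt_ellF hk _)
    (by have := Real.sqrt_pos.mpr (one_sub_sq_mul_sin_sq_pos hk (am u k)); positivity)
    (Eventually.of_forall (ellF_am hk))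
  simpa [dn, sn] using h

theorem hasDerivAt_sn (hk : k ∈ Ioo (0 : ℝ) 1) (u : ℝ) :
    HasDerivAt (fun u => sn u k) (cn u k * dn u k) u :=
  (hasDerivAt_am hk u).sin

theorem hasDerivAt_cn (hk : k ∈ Ioo (0 : ℝ) 1) (u : ℝ) :
    HasDerivAt (fun u => cn u k) (-(sn u k * dn u k)) u := by
  have := (hasDerivAt_am hk u).cos
  rwa [neg_mul] at this

theorem hasDerivAt_dn (hk : k ∈ Ioo (0 : ℝ) 1) (u : ℝ) :
    HasDerivAt (fun u => dn u k) (-(k ^ 2 * sn u k * cn u k)) u := by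
  have h := ((((hasDerivAt_sn hk u).fun_pow 2).const_mul (k ^ 2)).const_sub 1).sqrt
    (one_sub_sq_mul_sin_sq_pos hk _).ne'
  refine h.congr_deriv ?_
  have h1 : √(1 - k ^ 2 * sn u k ^ 2) = dn u k := rfl
  have := (dn_pos hk u).ne'
  rw [h1]
  push_cast
  field_simp

theorem continuous_sn (hk : k ∈ Ioo (0 : ℝ) 1) : Continuous fun u => sn u k :=
  Real.continuous_sin.comp (continuous_am hk)

theorem continuous_cn (hk : k ∈ Ioo (0 : ℝ) 1) : Continuous fun u => cn u k :=
  Real.continuous_cos.comp (continuous_am hk)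

theorem continuous_dn (hk : k ∈ Ioo (0 : ℝ) 1) : Continuous fun u => dn u k :=
  continuous_iff_continuousAt.mpr fun u => (hasDerivAt_dn hk u).continuousAt

/-! ### Parity, special values and shifts by 2K(k). -/

theorem ellF_neg (φ : ℝ) : ellF k (-φ) = -ellF k φ := by
  unfold ellF
  have := intervalIntegral.integral_comp_neg
    (a := 0) (b := φ) (fun θ : ℝ => 1 / √(1 - k ^ 2 * Real.sin θ ^ 2))
  simp only [Real.sin_neg, neg_sq, neg_zero] at this
  rw [this, intervalIntegral.integral_symm]

theorem ellF_add_pi (hk : k ∈ Ioo (0 : ℝ) 1) (φ : ℝ) :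
    ellF k (φ + Real.pi) = ellF k φ + 2 * ellK k := by
  have h : ∀ x, HasDerivAt (fun x => ellF k (x + Real.pi) - ellF k x) 0 x := fun x => by
    have := ((hasDerivAt_ellF hk (x + Real.pi)).comp_add_const x Real.pi).fun_sub
      (hasDerivAt_ellF hk x)
    simpa [Real.sin_add_pi] using this
  have := is_const_of_deriv_eq_zero (fun x => (h x).differentiableAt) (fun x => (h x).deriv) φ
    (-(Real.pi / 2))
  have h2 : -(Real.pi / 2) + Real.pi = Real.pi / 2 := by ring
  simp only [h2, ellF_neg] at this
  simp only [ellK]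
  linarith

theorem am_neg (hk : k ∈ Ioo (0 : ℝ) 1) (u : ℝ) : am (-u) k = -am u k := by
  apply (strictMono_ellF hk).injective
  rw [ellF_neg, ellF_am hk, ellF_am hk]

theorem am_add (hk : k ∈ Ioo (0 : ℝ) 1) (u : ℝ) : am (u + 2 * ellK k) k = am u k + Real.pi := by
  apply (strictMono_ellF hk).injective
  rw [ellF_add_pi hk, ellF_am hk, ellF_am hk]

theorem am_zero (hk : k ∈ Ioo (0 : ℝ) 1) : am 0 k = 0 := by
  simpa [ellF_zero] using am_ellF hk 0

theorem am_ellK (hk : k ∈ Ioo (0 : ℝ) 1) : am (ellK k) k = Real.pi / 2 := am_ellF hk _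

theorem ellK_pos (hk : k ∈ Ioo (0 : ℝ) 1) : 0 < ellK k := by
  have := strictMono_ellF hk (show (0 : ℝ) < Real.pi / 2 by positivity)
  rwa [ellF_zero] at this

theorem sn_zero (hk : k ∈ Ioo (0 : ℝ) 1) : sn 0 k = 0 := by simp [sn, am_zero hk]
theorem cn_zero (hk : k ∈ Ioo (0 : ℝ) 1) : cn 0 k = 1 := by simp [cn, am_zero hk]
theorem dn_zero (hk : k ∈ Ioo (0 : ℝ) 1) : dn 0 k = 1 := by simp [dn, sn_zero hk]
theorem sn_neg (hk : k ∈ Ioo (0 : ℝ) 1) (u : ℝ) : sn (-u) k = -sn u k := by simp [sn, am_neg hk]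
theorem cn_neg (hk : k ∈ Ioo (0 : ℝ) 1) (u : ℝ) : cn (-u) k = cn u k := by simp [cn, am_neg hk]
theorem dn_neg (hk : k ∈ Ioo (0 : ℝ) 1) (u : ℝ) : dn (-u) k = dn u k := by simp [dn, sn_neg hk]
theorem sn_ellK (hk : k ∈ Ioo (0 : ℝ) 1) : sn (ellK k) k = 1 := by simp [sn, am_ellK hk]
theorem cn_ellK (hk : k ∈ Ioo (0 : ℝ) 1) : cn (ellK k) k = 0 := by simp [cn, am_ellK hk]

theorem sn_add_two_ellK (hk : k ∈ Ioo (0 : ℝ) 1) (u : ℝ) : sn (u + 2 * ellK k) k = -sn u k := by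
  simp [sn, am_add hk, Real.sin_add_pi]

theorem cn_add_two_ellK (hk : k ∈ Ioo (0 : ℝ) 1) (u : ℝ) : cn (u + 2 * ellK k) k = -cn u k := by
  simp [cn, am_add hk, Real.cos_add_pi]

theorem dn_add_two_ellK (hk : k ∈ Ioo (0 : ℝ) 1) (u : ℝ) : dn (u + 2 * ellK k) k = dn u k := by
  simp [dn, sn_add_two_ellK hk]

theorem cn_pos (hk : k ∈ Ioo (0 : ℝ) 1) {u : ℝ} (hu : u ∈ Ioo (-ellK k) (ellK k)) :
    0 < cn u k := by
  have h1 := strictMono_am hk hu.1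
  have h2 := strictMono_am hk hu.2
  simp only [am_neg hk, am_ellK hk] at h1 h2
  exact Real.cos_pos_of_mem_Ioo ⟨h1, h2⟩

theorem sn_pos (hk : k ∈ Ioo (0 : ℝ) 1) {u : ℝ} (hu : u ∈ Ioo 0 (2 * ellK k)) :
    0 < sn u k := by
  have h1 := strictMono_am hk hu.1
  have h2 := strictMono_am hk hu.2
  have h3 := am_add hk 0
  simp only [am_zero hk, zero_add] at h1 h2 h3
  rw [h3] at h2
  exact Real.sin_pos_of_pos_of_lt_pi h1 h2

theorem sn_sq_lt_one (hk : k ∈ Ioo (0 : ℝ) 1) {u : ℝ} (hu : u ∈ Ioo (-ellK k) (ellK k)) :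
    sn u k ^ 2 < 1 := by
  have := cn_pos hk hu
  nlinarith [sn_sq_add_cn_sq (k := k) u]

/-! ### Addition theorems -/

theorem one_sub_pos_of_sn (hk : k ∈ Ioo (0 : ℝ) 1) (u v : ℝ) :
    0 < 1 - k ^ 2 * sn u k ^ 2 * sn v k ^ 2 := by
  have h1 := one_sub_sq_mul_sin_sq_pos hk (am u k)
  have h2 : sn v k ^ 2 ≤ 1 := Real.sin_sq_le_one _
  have h3 : 0 ≤ k ^ 2 * sn u k ^ 2 := by positivity
  change 0 < 1 - k ^ 2 * sn u k ^ 2 at h1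
  nlinarith

/-- For fixed a, the quotient of the left side by 1 - k² sn²t sn²(a-t) has zero derivative in t, and
at t = 0 it equals sn a. -/
theorem sn_add (hk : k ∈ Ioo (0 : ℝ) 1) (a t : ℝ) :
    sn t k * cn (a - t) k * dn (a - t) k + sn (a - t) k * cn t k * dn t k =
      sn a k * (1 - k ^ 2 * sn t k ^ 2 * sn (a - t) k ^ 2) := by
  have hd : ∀ t, HasDerivAt (fun t =>
      (sn t k * cn (a - t) k * dn (a - t) k + sn (a - t) k * cn t k * dn t k) /
      (1 - k ^ 2 * sn t k ^ 2 * sn (a - t) k ^ 2)) 0 t := fun t => by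
    have s1 := hasDerivAt_sn hk t
    have c1 := hasDerivAt_cn hk t
    have d1 := hasDerivAt_dn hk t
    have s2 := (hasDerivAt_sn hk (a - t)).comp_const_sub a t
    have c2 := (hasDerivAt_cn hk (a - t)).comp_const_sub a t
    have d2 := (hasDerivAt_dn hk (a - t)).comp_const_sub a t
    have hD := (one_sub_pos_of_sn hk t (a - t)).ne'
    have h := (((s1.fun_mul c2).fun_mul d2).fun_add ((s2.fun_mul c1).fun_mul d1)).fun_div
      ((((s1.fun_pow 2).const_mul (k ^ 2)).fun_mul (s2.fun_pow 2)).const_sub 1) hD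
    refine h.congr_deriv ?_
    rw [div_eq_zero_iff]
    left
    have e1 := sn_sq_add_cn_sq (k := k) t
    have e2 := sn_sq_add_cn_sq (k := k) (a - t)
    have e3 := dn_sq hk t
    have e4 := dn_sq hk (a - t)
    generalize sn t k = s at *
    generalize cn t k = c at *
    generalize dn t k = d at *
    generalize sn (a - t) k = s' at *
    generalize cn (a - t) k = c' at *
    generalize dn (a - t) k = d' at *
    -- For the quotient N/D, N' is s s' times the left side of `hA`, and -N D' is 2k² s s' times the
    -- left side of `hB`; the two contributions to N'D - N D' cancel.
    have hA : d' ^ 2 + k ^ 2 * c' ^ 2 - d ^ 2 - k ^ 2 * c ^ 2 = 2 * k ^ 2 * (s ^ 2 - s' ^ 2) := by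
      linear_combination e4 - e3 + k ^ 2 * e2 - k ^ 2 * e1
    have hB : s' ^ 2 * c ^ 2 * d ^ 2 - s ^ 2 * c' ^ 2 * d' ^ 2 =
        (s' ^ 2 - s ^ 2) * (1 - k ^ 2 * s ^ 2 * s' ^ 2) := by
      rw [e3, e4, show c ^ 2 = 1 - s ^ 2 by linarith, show c' ^ 2 = 1 - s' ^ 2 by linarith]
      ring
    linear_combination (s * s' * (1 - k ^ 2 * s ^ 2 * s' ^ 2)) * hA + 2 * k ^ 2 * s * s' * hB
  have := is_const_of_deriv_eq_zero (fun x => (hd x).differentiableAt) (fun x => (hd x).deriv) t 0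
  simp only [sub_zero, sn_zero hk, cn_zero hk, dn_zero hk] at this
  rw [div_eq_iff (one_sub_pos_of_sn hk t (a - t)).ne'] at this
  rw [this]
  ring

theorem sn_two_mul (hk : k ∈ Ioo (0 : ℝ) 1) (t : ℝ) :
    sn (2 * t) k = 2 * (sn t k * cn t k * dn t k) / (1 - k ^ 2 * sn t k ^ 4) := by
  have h := sn_add hk (2 * t) t
  have hD := one_sub_pos_of_sn hk t t
  rw [show 2 * t - t = t by ring] at h
  rw [eq_div_iff (by convert hD.ne' using 1; ring)]
  linear_combination -h

theorem hasDerivAt_sn_sq (hk : k ∈ Ioo (0 : ℝ) 1) (t : ℝ) :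
    HasDerivAt (fun t => sn t k ^ 2) (2 * (sn t k * cn t k * dn t k)) t := by
  refine ((hasDerivAt_sn hk t).fun_pow 2).congr_deriv ?_
  push_cast
  ring

theorem hasDerivAt_sn_mul_cn_mul_dn (hk : k ∈ Ioo (0 : ℝ) 1) (t : ℝ) :
    HasDerivAt (fun t => sn t k * cn t k * dn t k)
      (1 - 2 * (1 + k ^ 2) * sn t k ^ 2 + 3 * k ^ 2 * sn t k ^ 4) t := by
  refine (((hasDerivAt_sn hk t).fun_mul (hasDerivAt_cn hk t)).fun_mul
    (hasDerivAt_dn hk t)).congr_deriv ?_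
  have e1 := dn_sq hk t
  have e2 : cn t k ^ 2 = 1 - sn t k ^ 2 := by linarith [sn_sq_add_cn_sq (k := k) t]
  linear_combination (cn t k ^ 2 - sn t k ^ 2) * e1 +
    (1 - k ^ 2 * sn t k ^ 2 - k ^ 2 * sn t k ^ 2) * e2

/-- The derivative of the duplication formula for sn. -/
theorem cn_two_mul_mul_dn_two_mul (hk : k ∈ Ioo (0 : ℝ) 1) (t : ℝ) :
    cn (2 * t) k * dn (2 * t) k =
      (1 - 2 * (1 + k ^ 2) * sn t k ^ 2 + 3 * k ^ 2 * sn t k ^ 4) / (1 - k ^ 2 * sn t k ^ 4) +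
      k ^ 2 * sn t k ^ 2 * sn (2 * t) k ^ 2 := by
  have hD : 1 - k ^ 2 * sn t k ^ 4 ≠ 0 := by
    convert (one_sub_pos_of_sn hk t t).ne' using 1; ring
  have h1 : HasDerivAt (fun t => sn (2 * t) k) (cn (2 * t) k * dn (2 * t) k * (2 * 1)) t :=
    (hasDerivAt_sn hk (2 * t)).comp t ((hasDerivAt_id t).const_mul 2)
  have h2 := ((hasDerivAt_sn_mul_cn_mul_dn hk t).const_mul 2).fun_div
    ((((hasDerivAt_sn hk t).fun_pow 4).const_mul (k ^ 2)).const_sub 1) hD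
  rw [funext fun t => sn_two_mul hk t] at h1
  have h := h1.unique h2
  rw [sn_two_mul hk]
  push_cast at h
  have : cn (2 * t) k * dn (2 * t) k = cn (2 * t) k * dn (2 * t) k * (2 * 1) / 2 := by ring
  rw [this, h]
  field_simp
  ring

/-! ### The Zeta function of a real argument. -/

theorem continuous_zetaReal_integrand (hk : k ∈ Ioo (0 : ℝ) 1) :
    Continuous fun x => dn x k ^ 2 - ellE k / ellK k :=
  ((continuous_dn hk).pow 2).sub continuous_const

theorem hasDerivAt_zetaReal (hk : k ∈ Ioo (0 : ℝ) 1) (u : ℝ) :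
    HasDerivAt (fun u => zetaReal u k) (dn u k ^ 2 - ellE k / ellK k) u :=
  intervalIntegral.integral_hasDerivAt_right
    ((continuous_zetaReal_integrand hk).intervalIntegrable _ _)
    ((continuous_zetaReal_integrand hk).stronglyMeasurableAtFilter _ _)
    (continuous_zetaReal_integrand hk).continuousAt

theorem zetaReal_zero : zetaReal 0 k = 0 := by simp [zetaReal]

theorem zetaReal_neg (hk : k ∈ Ioo (0 : ℝ) 1) (u : ℝ) : zetaReal (-u) k = -zetaReal u k := by
  unfold zetaReal
  have := intervalIntegral.integral_comp_neg
    (a := 0) (b := u) (fun x : ℝ => dn x k ^ 2 - ellE k / ellK k)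
  simp only [dn_neg hk, neg_zero] at this
  rw [this, intervalIntegral.integral_symm]

/-- The substitution x = F(θ) turns the integral of dn² over [0, K] into E, so the constant E/K is
exactly the mean of dn². -/
theorem zetaReal_ellK (hk : k ∈ Ioo (0 : ℝ) 1) : zetaReal (ellK k) k = 0 := by
  have h := intervalIntegral.integral_comp_mul_deriv (a := 0) (b := Real.pi / 2)
    (f := ellF k) (g := fun x => dn x k ^ 2) (fun x _ => hasDerivAt_ellF hk x)
    (continuous_ellF_integrand hk).continuousOn ((continuous_dn hk).pow 2)
  have h1 : ∀ θ, ((fun x => dn x k ^ 2) ∘ ellF k) θ * (1 / √(1 - k ^ 2 * Real.sin θ ^ 2)) =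
      √(1 - k ^ 2 * Real.sin θ ^ 2) := fun θ => by
    simp only [Function.comp, dn, sn, am_ellF hk]
    have := (Real.sqrt_pos.mpr (one_sub_sq_mul_sin_sq_pos hk θ)).ne'
    field_simp
  simp only [h1, ellF_zero] at h
  unfold zetaReal
  have hc : Continuous fun x => dn x k ^ 2 := (continuous_dn hk).pow 2
  rw [intervalIntegral.integral_sub (hc.intervalIntegrable _ _)
    (continuous_const.intervalIntegrable _ _)]
  change _ = ∫ x in (0 : ℝ)..ellK k, dn x k ^ 2 at h
  rw [← h, intervalIntegral.integral_const, smul_eq_mul, sub_zero,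
    mul_div_cancel₀ _ (ellK_pos hk).ne']
  exact sub_self _

/-- The left side has zero derivative in t, by the addition theorem for sn, and at t = 0 it is Z(a).
-/
theorem zetaReal_add (hk : k ∈ Ioo (0 : ℝ) 1) (a t : ℝ) :
    zetaReal t k + zetaReal (a - t) k - k ^ 2 * sn t k * sn (a - t) k * sn a k =
      zetaReal a k := by
  have hd : ∀ t, HasDerivAt (fun t => zetaReal t k + zetaReal (a - t) k -
      k ^ 2 * sn t k * sn (a - t) k * sn a k) 0 t := fun t => by
    have s1 := hasDerivAt_sn hk t
    have s2 := (hasDerivAt_sn hk (a - t)).comp_const_sub a t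
    have z1 := hasDerivAt_zetaReal hk t
    have z2 := (hasDerivAt_zetaReal hk (a - t)).comp_const_sub a t
    refine ((z1.fun_add z2).fun_sub (((s1.const_mul (k ^ 2)).fun_mul s2).mul_const _)).congr_deriv ?_
    have hD := (one_sub_pos_of_sn hk t (a - t)).ne'
    have e0 := sn_add hk a t
    have e1 := sn_sq_add_cn_sq (k := k) t
    have e2 := sn_sq_add_cn_sq (k := k) (a - t)
    have e3 := dn_sq hk t
    have e4 := dn_sq hk (a - t)
    generalize sn t k = s at *
    generalize cn t k = c at *
    generalize dn t k = d at *
    generalize sn (a - t) k = s' at *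
    generalize cn (a - t) k = c' at *
    generalize dn (a - t) k = d' at *
    have hB : s' ^ 2 * c ^ 2 * d ^ 2 - s ^ 2 * c' ^ 2 * d' ^ 2 =
        (s' ^ 2 - s ^ 2) * (1 - k ^ 2 * s ^ 2 * s' ^ 2) := by
      rw [e3, e4, show c ^ 2 = 1 - s ^ 2 by linarith, show c' ^ 2 = 1 - s' ^ 2 by linarith]
      ring
    refine mul_left_cancel₀ hD ?_
    linear_combination (1 - k ^ 2 * s ^ 2 * s' ^ 2) * (e3 - e4) +
      k ^ 2 * (s' * c * d - s * c' * d') * e0 - k ^ 2 * hB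
  have := is_const_of_deriv_eq_zero (fun x => (hd x).differentiableAt) (fun x => (hd x).deriv) t 0
  simp only [sub_zero, sn_zero hk, zetaReal_zero] at this
  rw [this]
  ring

theorem zetaReal_two_mul (hk : k ∈ Ioo (0 : ℝ) 1) (t : ℝ) :
    zetaReal (2 * t) k = 2 * zetaReal t k - k ^ 2 * sn t k ^ 2 * sn (2 * t) k := by
  have h := zetaReal_add hk (2 * t) t
  rw [show 2 * t - t = t by ring] at h
  linear_combination -h

/-- This combination at 2t = 4δK/L, with modulus k', enters the wave speed. In the duplication
formulas for Z and for cn·dn the terms k² sn²(t) sn(2t) cancel. -/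
theorem zetaReal_two_mul_add (hk : k ∈ Ioo (0 : ℝ) 1) {t : ℝ}
    (ht : sn t k * cn t k * dn t k ≠ 0) :
    zetaReal (2 * t) k + cn (2 * t) k * dn (2 * t) k / sn (2 * t) k =
      2 * zetaReal t k + (1 - 2 * (1 + k ^ 2) * sn t k ^ 2 + 3 * k ^ 2 * sn t k ^ 4) /
        (2 * (sn t k * cn t k * dn t k)) := by
  have hD : 1 - k ^ 2 * sn t k ^ 4 ≠ 0 := by
    convert (one_sub_pos_of_sn hk t t).ne' using 1; ring
  rw [cn_two_mul_mul_dn_two_mul hk, zetaReal_two_mul hk, sn_two_mul hk]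
  generalize sn t k * cn t k * dn t k = S at *
  field_simp
  ring

end Jacobi

/-! ### The imaginary part of the Zeta function -/

section ZetaIm

open Filter Topology

variable {k : ℝ}

theorem compl_mem (hk : k ∈ Ioo (0 : ℝ) 1) : compl k ∈ Ioo (0 : ℝ) 1 := by
  have h : k ^ 2 < 1 := by nlinarith [hk.1, hk.2]
  refine ⟨Real.sqrt_pos.mpr (by linarith), ?_⟩
  rw [compl, Real.sqrt_lt' one_pos]
  nlinarith [hk.1, sq_pos_of_pos hk.1]

theorem compl_sq (hk : k ∈ Ioo (0 : ℝ) 1) : compl k ^ 2 = 1 - k ^ 2 :=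
  Real.sq_sqrt (by nlinarith [hk.1, hk.2])

theorem compl_compl (hk : k ∈ Ioo (0 : ℝ) 1) : compl (compl k) = k := by
  rw [compl, compl_sq hk, sub_sub_cancel, Real.sqrt_sq hk.1.le]

/-- The imaginary part of `Z(u + iv; k)`. -/
def zetaIm (k u v : ℝ) : ℝ :=
  dn u k ^ 2 * (sn v (compl k) * cn v (compl k) * dn v (compl k)) /
      (1 - dn u k ^ 2 * sn v (compl k) ^ 2) - zetaReal v (compl k)
    - Real.pi * v / (2 * ellK k * ellK (compl k))

/-- `∂Im Z(u + iv; k) / ∂v`. -/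
def zetaImV (k u v : ℝ) : ℝ :=
  let X := dn u k ^ 2
  let y := sn v (compl k) ^ 2
  let m := compl k ^ 2
  X * (1 - 2 * (1 + m) * y + 3 * m * y ^ 2) / (1 - X * y) +
    2 * X ^ 2 * (y * (1 - y) * (1 - m * y)) / (1 - X * y) ^ 2 -
    (1 - m * y - ellE (compl k) / ellK (compl k)) -
    Real.pi / (2 * ellK k * ellK (compl k))

/-- `∂²Im Z(u + iv; k) / ∂v²`. -/
def zetaImVV (k u v : ℝ) : ℝ :=
  let X := dn u k ^ 2
  let y := sn v (compl k) ^ 2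
  let m := compl k ^ 2
  2 * (sn v (compl k) * cn v (compl k) * dn v (compl k)) *
    (X * (-2 * (1 + m) + 6 * m * y) / (1 - X * y) +
      3 * X ^ 2 * (1 - 2 * (1 + m) * y + 3 * m * y ^ 2) / (1 - X * y) ^ 2 +
      4 * X ^ 3 * (y * (1 - y) * (1 - m * y)) / (1 - X * y) ^ 3 + m)

/-- `∂Im Z(u + iv; k) / ∂u`. -/
def zetaImU (k u v : ℝ) : ℝ :=
  sn v (compl k) * cn v (compl k) * dn v (compl k) *
    (-2 * k ^ 2 * (sn u k * cn u k * dn u k)) / (1 - dn u k ^ 2 * sn v (compl k) ^ 2) ^ 2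

theorem one_sub_dn_sq_mul_sn_sq_pos (hk : k ∈ Ioo (0 : ℝ) 1) (u : ℝ) {v : ℝ}
    (hv : v ∈ Ioo (-ellK (compl k)) (ellK (compl k))) :
    0 < 1 - dn u k ^ 2 * sn v (compl k) ^ 2 := by
  have h1 := sn_sq_lt_one (compl_mem hk) hv
  have h2 := dn_le_one (k := k) u
  have h3 := dn_pos hk u
  have h4 : dn u k ^ 2 ≤ 1 := by nlinarith
  nlinarith [sq_nonneg (sn v (compl k))]

theorem hasDerivAt_zetaIm_right (hk : k ∈ Ioo (0 : ℝ) 1) (u : ℝ) {v : ℝ}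
    (hv : v ∈ Ioo (-ellK (compl k)) (ellK (compl k))) :
    HasDerivAt (fun v => zetaIm k u v) (zetaImV k u v) v := by
  have hk' := compl_mem hk
  have hD := (one_sub_dn_sq_mul_sn_sq_pos hk u hv).ne'
  have h := ((((hasDerivAt_sn_mul_cn_mul_dn hk' v).const_mul (dn u k ^ 2)).fun_div
    (((hasDerivAt_sn_sq hk' v).const_mul (dn u k ^ 2)).const_sub 1) hD).fun_sub
    (hasDerivAt_zetaReal hk' v)).fun_sub
    (((hasDerivAt_id v).const_mul Real.pi).div_const (2 * ellK k * ellK (compl k)))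
  refine h.congr_deriv ?_
  -- Squaring makes sn·cn·dn a polynomial in sn², so the v-derivative is rational in dn²(u) and
  -- sn²(v) alone.
  have e : (sn v (compl k) * cn v (compl k) * dn v (compl k)) ^ 2 =
      sn v (compl k) ^ 2 * (1 - sn v (compl k) ^ 2) * (1 - compl k ^ 2 * sn v (compl k) ^ 2) := by
    rw [← dn_sq hk', ← sn_sq_add_cn_sq (k := compl k) v]
    ring
  simp only [zetaImV, mul_one, ← e, dn_sq hk' v]
  generalize sn v (compl k) * cn v (compl k) * dn v (compl k) = S
  congr 2
  field_simp
  ring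

theorem hasDerivAt_zetaImV_right (hk : k ∈ Ioo (0 : ℝ) 1) (u : ℝ) {v : ℝ}
    (hv : v ∈ Ioo (-ellK (compl k)) (ellK (compl k))) :
    HasDerivAt (fun v => zetaImV k u v) (zetaImVV k u v) v := by
  have hk' := compl_mem hk
  have hD := (one_sub_dn_sq_mul_sn_sq_pos hk u hv).ne'
  have hy := hasDerivAt_sn_sq hk' v
  have hA : HasDerivAt (fun v => 1 - 2 * (1 + compl k ^ 2) * sn v (compl k) ^ 2 +
      3 * compl k ^ 2 * (sn v (compl k) ^ 2) ^ 2) ((-2 * (1 + compl k ^ 2) +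
        6 * compl k ^ 2 * sn v (compl k) ^ 2) *
      (2 * (sn v (compl k) * cn v (compl k) * dn v (compl k)))) v := by
    refine (((hy.const_mul (2 * (1 + compl k ^ 2))).const_sub 1).fun_add
      ((hy.fun_pow 2).const_mul (3 * compl k ^ 2))).congr_deriv ?_
    push_cast
    ring
  have hB : HasDerivAt (fun v => sn v (compl k) ^ 2 * (1 - sn v (compl k) ^ 2) *
      (1 - compl k ^ 2 * sn v (compl k) ^ 2)) ((1 - 2 * (1 + compl k ^ 2) * sn v (compl k) ^ 2 +
        3 * compl k ^ 2 * (sn v (compl k) ^ 2) ^ 2) *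
      (2 * (sn v (compl k) * cn v (compl k) * dn v (compl k)))) v := by
    refine ((hy.fun_mul (hy.const_sub 1)).fun_mul
      ((hy.const_mul (compl k ^ 2)).const_sub 1)).congr_deriv ?_
    ring
  have hDd := (hy.const_mul (dn u k ^ 2)).const_sub 1
  have h := ((((hA.const_mul (dn u k ^ 2)).fun_div hDd hD).fun_add
    ((hB.const_mul (2 * (dn u k ^ 2) ^ 2)).fun_div (hDd.fun_pow 2) (pow_ne_zero 2 hD))).fun_sub
    (((hy.const_mul (compl k ^ 2)).const_sub 1).sub_const
      (ellE (compl k) / ellK (compl k)))).sub_const (Real.pi / (2 * ellK k * ellK (compl k)))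
  refine h.congr_deriv ?_
  simp only [zetaImVV]
  generalize sn v (compl k) * cn v (compl k) * dn v (compl k) = S
  generalize sn v (compl k) ^ 2 = y at *
  generalize dn u k ^ 2 = X at *
  generalize compl k ^ 2 = m at *
  push_cast
  field_simp
  ring

theorem hasDerivAt_zetaIm_left (hk : k ∈ Ioo (0 : ℝ) 1) (u : ℝ) {v : ℝ}
    (hv : v ∈ Ioo (-ellK (compl k)) (ellK (compl k))) :
    HasDerivAt (fun u => zetaIm k u v) (zetaImU k u v) u := by
  have hD := (one_sub_dn_sq_mul_sn_sq_pos hk u hv).ne'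
  have hX : HasDerivAt (fun u => dn u k ^ 2) (-2 * k ^ 2 * (sn u k * cn u k * dn u k)) u := by
    refine ((hasDerivAt_dn hk u).fun_pow 2).congr_deriv ?_
    push_cast
    ring
  have h := ((((hX.mul_const (sn v (compl k) * cn v (compl k) * dn v (compl k))).fun_div
    ((hX.mul_const (sn v (compl k) ^ 2)).const_sub 1) hD).sub_const
      (zetaReal v (compl k))).sub_const (Real.pi * v / (2 * ellK k * ellK (compl k))))
  refine h.congr_deriv ?_
  simp only [zetaImU]
  generalize sn v (compl k) * cn v (compl k) * dn v (compl k) = S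
  field_simp
  ring

/-- `Im Z(u + iv; k)` is harmonic. -/
theorem hasDerivAt_zetaImU_left (hk : k ∈ Ioo (0 : ℝ) 1) (u : ℝ) {v : ℝ}
    (hv : v ∈ Ioo (-ellK (compl k)) (ellK (compl k))) :
    HasDerivAt (fun u => zetaImU k u v) (-zetaImVV k u v) u := by
  have hD := (one_sub_dn_sq_mul_sn_sq_pos hk u hv).ne'
  have hX : HasDerivAt (fun u => dn u k ^ 2) (-2 * k ^ 2 * (sn u k * cn u k * dn u k)) u := by
    refine ((hasDerivAt_dn hk u).fun_pow 2).congr_deriv ?_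
    push_cast
    ring
  have h := (((hasDerivAt_sn_mul_cn_mul_dn hk u).const_mul (-2 * k ^ 2)).const_mul
    (sn v (compl k) * cn v (compl k) * dn v (compl k))).fun_div
    (((hX.mul_const (sn v (compl k) ^ 2)).const_sub 1).fun_pow 2) (pow_ne_zero 2 hD)
  refine h.congr_deriv ?_
  have e : (sn u k * cn u k * dn u k) ^ 2 =
      sn u k ^ 2 * (1 - sn u k ^ 2) * (1 - k ^ 2 * sn u k ^ 2) := by
    rw [← dn_sq hk, ← sn_sq_add_cn_sq (k := k) u]
    ring
  simp only [zetaImVV, compl_sq hk]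
  rw [show sn u k ^ 4 = (sn u k ^ 2) ^ 2 by ring]
  rw [dn_sq hk] at hD ⊢
  generalize sn v (compl k) * cn v (compl k) * dn v (compl k) = S
  generalize sn u k * cn u k * dn u k = T at *
  generalize sn v (compl k) ^ 2 = y at *
  generalize sn u k ^ 2 = x at *
  generalize k ^ 2 = m at *
  push_cast
  field_simp
  ring_nf
  simp only [e]
  ring

end ZetaIm

/-! ### Fourier coefficients of the imaginary part of the Zeta function -/

section ZetaFourier

open Filter Topology Interval

variable {k : ℝ}

/-- Compactness of a closed ball times [a, b] bounds the derivative uniformly, so dominated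
differentiation applies. The case 𝕜 = ℝ serves the Fourier integrals in v, and 𝕜 = ℂ the dependence
of K on the modulus. -/
theorem hasDerivAt_intervalIntegral_of_continuousOn {𝕜 E : Type*} [RCLike 𝕜]
    [NormedAddCommGroup E] [NormedSpace ℝ E] [NormedSpace 𝕜 E] {F F' : 𝕜 → ℝ → E} {U : Set 𝕜}
    {a b : ℝ} (hU : IsOpen U) (hF : ContinuousOn (Function.uncurry F) (U ×ˢ univ))
    (hF' : ContinuousOn (Function.uncurry F') (U ×ˢ univ))
    (hd : ∀ v ∈ U, ∀ u, HasDerivAt (fun v => F v u) (F' v u) v) {v : 𝕜} (hv : v ∈ U) :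
    HasDerivAt (fun v => ∫ u in a..b, F v u) (∫ u in a..b, F' v u) v := by
  obtain ⟨ε, hε, hB⟩ := Metric.nhds_basis_closedBall.mem_iff.mp (hU.mem_nhds hv)
  have hc : IsCompact (Metric.closedBall v ε ×ˢ uIcc a b) :=
    (isCompact_closedBall v ε).prod isCompact_uIcc
  obtain ⟨C, hC⟩ := hc.exists_bound_of_continuousOn
    (hF'.mono (prod_mono hB (subset_univ _)))
  have hs : ∀ w ∈ U, Continuous (F w) := fun w hw =>
    continuousOn_univ.mp (hF.comp (g := Function.uncurry F) (f := fun u : ℝ => (w, u))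
      (by fun_prop) fun u _ => ⟨hw, mem_univ _⟩)
  have hs' : ∀ w ∈ U, Continuous (F' w) := fun w hw =>
    continuousOn_univ.mp (hF'.comp (g := Function.uncurry F') (f := fun u : ℝ => (w, u))
      (by fun_prop) fun u _ => ⟨hw, mem_univ _⟩)
  refine (intervalIntegral.hasDerivAt_integral_of_dominated_loc_of_deriv_le
    (F := F) (F' := F') (bound := fun _ => C)
    (Metric.closedBall_mem_nhds v hε) ?_ ?_ ?_ ?_ ?_ ?_).2
  · filter_upwards [hU.mem_nhds hv] with w hw using (hs w hw).aestronglyMeasurable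
  · exact (hs v hv).intervalIntegrable _ _
  · exact (hs' v hv).aestronglyMeasurable
  · exact Eventually.of_forall fun u hu w hw => hC (w, u) ⟨hw, uIoc_subset_uIcc hu⟩
  · exact continuous_const.intervalIntegrable _ _
  · exact Eventually.of_forall fun u _ w hw => hd w (hB hw) u

/-- Solutions of `a'' = μ² a` with `a(0) = 0`. -/
theorem eq_sinh_of_hasDerivAt {μ R : ℝ} (hR : 0 < R) {a a' : ℝ → ℂ}
    (h1 : ∀ v ∈ Ioo (-R) R, HasDerivAt a (a' v) v)
    (h2 : ∀ v ∈ Ioo (-R) R, HasDerivAt a' (μ ^ 2 * a v) v) (h0 : a 0 = 0) {v : ℝ}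
    (hv : v ∈ Ioo (-R) R) :
    a' v = a' 0 * Real.cosh (μ * v) ∧ μ * a v = a' 0 * Real.sinh (μ * v) := by
  have hcos : ∀ v : ℝ, HasDerivAt (fun v : ℝ => (Real.cosh (μ * v) : ℂ))
      ((μ * Real.sinh (μ * v) : ℝ) : ℂ) v := fun v => by
    refine HasDerivAt.ofReal_comp ?_
    simpa [mul_comm] using ((hasDerivAt_id v).const_mul μ).cosh
  have hsin : ∀ v : ℝ, HasDerivAt (fun v : ℝ => (Real.sinh (μ * v) : ℂ))
      ((μ * Real.cosh (μ * v) : ℝ) : ℂ) v := fun v => by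
    refine HasDerivAt.ofReal_comp ?_
    simpa [mul_comm] using ((hasDerivAt_id v).const_mul μ).sinh
  have hm : (0 : ℝ) ∈ Ioo (-R) R := ⟨by linarith, hR⟩
  have hconst : ∀ f : ℝ → ℂ, (∀ v ∈ Ioo (-R) R, HasDerivAt f 0 v) → f v = f 0 := fun f hf =>
    isOpen_Ioo.is_const_of_deriv_eq_zero isPreconnected_Ioo
      (fun w hw => (hf w hw).differentiableAt.differentiableWithinAt)
      (fun w hw => (hf w hw).deriv) hv hm
  -- Two first integrals of the equation; cosh² - sinh² = 1 then solves for a' and μa. Keeping μa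
  -- undivided lets the lemma cover μ = 0.
  have hA := hconst (fun v => a' v * Real.cosh (μ * v) - μ * a v * Real.sinh (μ * v))
    fun w hw => by
      refine (((h2 w hw).fun_mul (hcos w)).fun_sub
        (((h1 w hw).const_mul (μ : ℂ)).fun_mul (hsin w))).congr_deriv ?_
      push_cast
      ring
  have hB := hconst (fun v => a' v * Real.sinh (μ * v) - μ * a v * Real.cosh (μ * v))
    fun w hw => by
      refine (((h2 w hw).fun_mul (hsin w)).fun_sub
        (((h1 w hw).const_mul (μ : ℂ)).fun_mul (hcos w))).congr_deriv ?_
      push_cast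
      ring
  have hs : (Real.cosh (μ * v) : ℂ) ^ 2 - (Real.sinh (μ * v) : ℂ) ^ 2 = 1 := by
    exact_mod_cast Real.cosh_sq_sub_sinh_sq (μ * v)
  simp only [mul_zero, Real.cosh_zero, Real.sinh_zero, h0, Complex.ofReal_one,
    Complex.ofReal_zero, mul_one, sub_zero] at hA hB
  constructor
  · linear_combination (Real.cosh (μ * v) : ℂ) * hA - (Real.sinh (μ * v) : ℂ) * hB - a' v * hs
  · linear_combination (Real.sinh (μ * v) : ℂ) * hA - (Real.cosh (μ * v) : ℂ) * hB - μ * a v * hs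

/-- The character `e^{-iμu}`. -/
def expI (μ u : ℝ) : ℂ := Complex.exp (-(μ * u * Complex.I))

theorem hasDerivAt_expI (μ u : ℝ) : HasDerivAt (expI μ) (-(μ * Complex.I) * expI μ u) u := by
  have h : HasDerivAt (fun u : ℝ => -((μ : ℂ) * u * Complex.I)) (-(μ * 1 * Complex.I)) u :=
    (((Complex.ofRealCLM.hasDerivAt (x := u)).const_mul (μ : ℂ)).mul_const Complex.I).neg
  refine h.cexp.congr_deriv ?_
  simp only [expI]
  ring

theorem continuous_expI (μ : ℝ) : Continuous (expI μ) := by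
  unfold expI
  fun_prop

theorem norm_expI (μ u : ℝ) : ‖expI μ u‖ = 1 := by
  rw [expI, show -((μ : ℂ) * u * Complex.I) = ((-(μ * u) : ℝ) : ℂ) * Complex.I by push_cast; ring]
  exact Complex.norm_exp_ofReal_mul_I _

theorem expI_neg_period {P : ℝ} (hP : P ≠ 0) (n : ℤ) :
    expI (n * Real.pi / P) (-P) = expI (n * Real.pi / P) P := by
  have hP' : (P : ℂ) ≠ 0 := by exact_mod_cast hP
  rw [expI, expI, Complex.exp_eq_exp_iff_exists_int]
  refine ⟨n, ?_⟩
  push_cast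
  field_simp
  ring

theorem integral_expI {P : ℝ} (hP : 0 < P) {n : ℤ} (hn : n ≠ 0) :
    ∫ u in (-P)..P, expI (n * Real.pi / P) u = 0 := by
  have hμ : ((n * Real.pi / P : ℝ) : ℂ) ≠ 0 := by
    have : (n : ℝ) ≠ 0 := by exact_mod_cast hn
    have := Real.pi_ne_zero
    exact_mod_cast (by positivity)
  have h := intervalIntegral.integral_eq_sub_of_hasDerivAt (a := -P) (b := P)
    (fun u _ => hasDerivAt_expI (n * Real.pi / P) u)
    ((continuous_const.mul (continuous_expI _)).intervalIntegrable _ _)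
  rw [expI_neg_period hP.ne', sub_self, intervalIntegral.integral_const_mul] at h
  rcases mul_eq_zero.mp h with h | h
  · exact absurd (by simpa [Complex.I_ne_zero] using h) hμ
  · exact h

theorem continuous_denominator (hk : k ∈ Ioo (0 : ℝ) 1) :
    Continuous fun p : ℝ × ℝ => 1 - dn p.2 k ^ 2 * sn p.1 (compl k) ^ 2 :=
  continuous_const.sub ((((continuous_dn hk).comp continuous_snd).pow 2).mul
    (((continuous_sn (compl_mem hk)).comp continuous_fst).pow 2))

theorem continuous_zetaReal (hk : k ∈ Ioo (0 : ℝ) 1) : Continuous fun u => zetaReal u k :=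
  continuous_iff_continuousAt.mpr fun u => (hasDerivAt_zetaReal hk u).continuousAt

theorem continuousOn_zetaIm (hk : k ∈ Ioo (0 : ℝ) 1) :
    ContinuousOn (fun p : ℝ × ℝ => zetaIm k p.2 p.1)
      (Ioo (-ellK (compl k)) (ellK (compl k)) ×ˢ univ) := by
  have hk' := compl_mem hk
  have h0 := (continuous_dn hk).comp (continuous_snd (X := ℝ) (Y := ℝ))
  have h1 := (continuous_sn hk').comp (continuous_fst (X := ℝ) (Y := ℝ))
  have h2 := (continuous_cn hk').comp (continuous_fst (X := ℝ) (Y := ℝ))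
  have h3 := (continuous_dn hk').comp (continuous_fst (X := ℝ) (Y := ℝ))
  have h4 := (continuous_zetaReal hk').comp (continuous_fst (X := ℝ) (Y := ℝ))
  refine (((h0.pow 2).mul ((h1.mul h2).mul h3)).continuousOn.div
    (continuous_denominator hk).continuousOn fun p hp =>
      (one_sub_dn_sq_mul_sn_sq_pos hk p.2 hp.1).ne').sub h4.continuousOn |>.sub ?_
  exact (Continuous.div_const (by fun_prop) _).continuousOn

theorem continuousOn_zetaImV (hk : k ∈ Ioo (0 : ℝ) 1) :
    ContinuousOn (fun p : ℝ × ℝ => zetaImV k p.2 p.1)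
      (Ioo (-ellK (compl k)) (ellK (compl k)) ×ˢ univ) := by
  have h0 : Continuous fun p : ℝ × ℝ => dn p.2 k := (continuous_dn hk).comp continuous_snd
  have h1 : Continuous fun p : ℝ × ℝ => sn p.1 (compl k) :=
    (continuous_sn (compl_mem hk)).comp continuous_fst
  have hD := fun (p : ℝ × ℝ) (hp : p ∈ Ioo (-ellK (compl k)) (ellK (compl k)) ×ˢ univ) =>
    (one_sub_dn_sq_mul_sn_sq_pos hk p.2 hp.1).ne'
  unfold zetaImV
  refine (((ContinuousOn.div ?_ ?_ hD).add (ContinuousOn.div ?_ ?_ fun p hp =>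
    pow_ne_zero 2 (hD p hp))).sub ?_).sub continuousOn_const
  all_goals exact Continuous.continuousOn (by fun_prop)

theorem continuousOn_zetaImVV (hk : k ∈ Ioo (0 : ℝ) 1) :
    ContinuousOn (fun p : ℝ × ℝ => zetaImVV k p.2 p.1)
      (Ioo (-ellK (compl k)) (ellK (compl k)) ×ˢ univ) := by
  have h0 : Continuous fun p : ℝ × ℝ => dn p.2 k := (continuous_dn hk).comp continuous_snd
  have h1 : Continuous fun p : ℝ × ℝ => sn p.1 (compl k) :=
    (continuous_sn (compl_mem hk)).comp continuous_fst
  have h2 : Continuous fun p : ℝ × ℝ => cn p.1 (compl k) :=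
    (continuous_cn (compl_mem hk)).comp continuous_fst
  have h3 : Continuous fun p : ℝ × ℝ => dn p.1 (compl k) :=
    (continuous_dn (compl_mem hk)).comp continuous_fst
  have hD := fun (p : ℝ × ℝ) (hp : p ∈ Ioo (-ellK (compl k)) (ellK (compl k)) ×ˢ univ) =>
    (one_sub_dn_sq_mul_sn_sq_pos hk p.2 hp.1).ne'
  unfold zetaImVV
  refine ContinuousOn.mul ?_ ((((ContinuousOn.div ?_ ?_ hD).add (ContinuousOn.div ?_ ?_ fun p hp =>
    pow_ne_zero 2 (hD p hp))).add (ContinuousOn.div ?_ ?_ fun p hp =>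
    pow_ne_zero 3 (hD p hp))).add continuousOn_const)
  all_goals exact Continuous.continuousOn (by fun_prop)

/-- Unnormalized Fourier integral over one period of a function of `u`. -/
def periodIntegral (k : ℝ) (f : ℝ → ℝ) (n : ℤ) : ℂ :=
  ∫ u in (-ellK k)..ellK k, (f u : ℂ) * expI (n * Real.pi / ellK k) u

theorem hasDerivAt_periodIntegral {f f' : ℝ → ℝ → ℝ} {U : Set ℝ} (hU : IsOpen U)
    (hf : ContinuousOn (fun p : ℝ × ℝ => f p.2 p.1) (U ×ˢ univ))
    (hf' : ContinuousOn (fun p : ℝ × ℝ => f' p.2 p.1) (U ×ˢ univ))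
    (hd : ∀ v ∈ U, ∀ u, HasDerivAt (fun v => f u v) (f' u v) v) (n : ℤ) {v : ℝ} (hv : v ∈ U) :
    HasDerivAt (fun v => periodIntegral k (fun u => f u v) n)
      (periodIntegral k (fun u => f' u v) n) v := by
  have he : ContinuousOn (fun p : ℝ × ℝ => expI (n * Real.pi / ellK k) p.2) (U ×ˢ univ) :=
    ((continuous_expI _).comp continuous_snd).continuousOn
  exact hasDerivAt_intervalIntegral_of_continuousOn (𝕜 := ℝ)
    (F := fun v u => (f u v : ℂ) * expI (n * Real.pi / ellK k) u)
    (F' := fun v u => (f' u v : ℂ) * expI (n * Real.pi / ellK k) u) hU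
    ((Complex.continuous_ofReal.comp_continuousOn hf).mul he)
    ((Complex.continuous_ofReal.comp_continuousOn hf').mul he)
    (fun w hw u => (hd w hw u).ofReal_comp.mul_const _) hv

/-- Integration by parts; the boundary terms cancel by periodicity. -/
theorem periodIntegral_deriv (hk : k ∈ Ioo (0 : ℝ) 1) {f f' : ℝ → ℝ}
    (hd : ∀ u, HasDerivAt f (f' u) u) (hf' : Continuous f')
    (hp : Function.Periodic f (2 * ellK k)) (n : ℤ) :
    periodIntegral k f' n =
      (n * Real.pi / ellK k : ℝ) * Complex.I * periodIntegral k f n := by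
  have h := intervalIntegral.integral_mul_deriv_eq_deriv_mul (a := -ellK k) (b := ellK k)
    (u := expI (n * Real.pi / ellK k)) (v := fun u => (f u : ℂ))
    (fun u _ => hasDerivAt_expI _ u) (fun u _ => (hd u).ofReal_comp)
    ((continuous_const.mul (continuous_expI _)).intervalIntegrable _ _)
    ((Complex.continuous_ofReal.comp hf').intervalIntegrable _ _)
  have hper : f (-ellK k) = f (ellK k) := by
    rw [← hp (-ellK k)]
    congr 1
    ring
  rw [expI_neg_period (ellK_pos hk).ne', hper, sub_self, zero_sub] at h
  simp only [periodIntegral]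
  rw [← intervalIntegral.integral_const_mul, ← neg_neg (∫ u in _.._, _ * _),
    ← intervalIntegral.integral_neg, intervalIntegral.integral_neg]
  simp only [mul_comm ((f' _ : ℝ) : ℂ)]
  rw [h, neg_neg, ← intervalIntegral.integral_neg]
  congr 1
  funext u
  ring

theorem zetaIm_periodic (hk : k ∈ Ioo (0 : ℝ) 1) (v : ℝ) :
    Function.Periodic (fun u => zetaIm k u v) (2 * ellK k) := fun u => by
  simp only [zetaIm, dn_add_two_ellK hk]

theorem zetaImU_periodic (hk : k ∈ Ioo (0 : ℝ) 1) (v : ℝ) :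
    Function.Periodic (fun u => zetaImU k u v) (2 * ellK k) := fun u => by
  simp only [zetaImU, dn_add_two_ellK hk, sn_add_two_ellK hk, cn_add_two_ellK hk]
  ring

/-- By harmonicity ∂_v² is -∂_u², and two integrations by parts in u give -(iμ)² = μ². -/
theorem periodIntegral_zetaImVV (hk : k ∈ Ioo (0 : ℝ) 1) {v : ℝ}
    (hv : v ∈ Ioo (-ellK (compl k)) (ellK (compl k))) (n : ℤ) :
    periodIntegral k (fun u => zetaImVV k u v) n =
      (n * Real.pi / ellK k : ℝ) ^ 2 * periodIntegral k (fun u => zetaIm k u v) n := by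
  have hc : Continuous fun u => zetaImVV k u v :=
    continuousOn_univ.mp ((continuousOn_zetaImVV hk).comp (f := fun u : ℝ => (v, u))
      (by fun_prop) fun u _ => ⟨hv, mem_univ _⟩)
  have h1 := periodIntegral_deriv hk (fun u => hasDerivAt_zetaImU_left hk u hv) hc.neg
    (zetaImU_periodic hk v) n
  have h2 := periodIntegral_deriv hk (fun u => hasDerivAt_zetaIm_left hk u hv)
    (continuous_iff_continuousAt.mpr fun u => (hasDerivAt_zetaImU_left hk u hv).continuousAt)
    (zetaIm_periodic hk v) n
  rw [h2] at h1
  have h3 : periodIntegral k (fun u => -zetaImVV k u v) n =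
      -periodIntegral k (fun u => zetaImVV k u v) n := by
    simp only [periodIntegral, Complex.ofReal_neg, neg_mul, intervalIntegral.integral_neg]
  rw [h3] at h1
  linear_combination -h1 - (n * Real.pi / ellK k : ℝ) ^ 2 *
    periodIntegral k (fun u => zetaIm k u v) n * Complex.I_sq

theorem zetaIm_zero (hk : k ∈ Ioo (0 : ℝ) 1) (u : ℝ) : zetaIm k u 0 = 0 := by
  simp [zetaIm, sn_zero (compl_mem hk), zetaReal_zero]

/-! ### The boundary behaviour as `v` tends to `K(k')` -/

theorem image_ellF_arctan (hk : k ∈ Ioo (0 : ℝ) 1) {c : ℝ} (hc : 0 < c) :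
    (fun t => ellF k (Real.arctan (t / c))) '' univ = Ioo (-ellK k) (ellK k) := by
  ext u
  constructor
  · rintro ⟨t, -, rfl⟩
    constructor
    · rw [ellK, ← ellF_neg]
      exact strictMono_ellF hk (Real.neg_pi_div_two_lt_arctan _)
    · exact strictMono_ellF hk (Real.arctan_lt_pi_div_two _)
  · intro hu
    refine ⟨c * Real.tan (am u k), mem_univ _, ?_⟩
    have h1 := strictMono_am hk hu.1
    have h2 := strictMono_am hk hu.2
    simp only [am_neg hk, am_ellK hk] at h1 h2
    simp only
    rw [mul_div_cancel_left₀ _ hc.ne', Real.arctan_tan h1 h2, ellF_am hk]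

/-- The substitution t = c tan(am u) with c = dn(v)/cn(v) turns the kernel, which peaks at u = 0 as
v → K', into the Cauchy density 1/(1+t²) times a bounded factor. -/
theorem integral_kernel_eq (hk : k ∈ Ioo (0 : ℝ) 1) {v : ℝ} (hv : v ∈ Ioo 0 (ellK (compl k)))
    (g : ℝ → ℂ) :
    ∫ u in (-ellK k)..ellK k, ((dn u k ^ 2 * (sn v (compl k) * cn v (compl k) * dn v (compl k)) /
      (1 - dn u k ^ 2 * sn v (compl k) ^ 2) : ℝ) : ℂ) * g u =
    ∫ t : ℝ, ((sn v (compl k) * dn (ellF k (Real.arctan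
        (t / (dn v (compl k) / cn v (compl k))))) k * (1 + t ^ 2)⁻¹ : ℝ) : ℂ) *
      g (ellF k (Real.arctan (t / (dn v (compl k) / cn v (compl k))))) := by
  have hk' := compl_mem hk
  have hv' : v ∈ Ioo (-ellK (compl k)) (ellK (compl k)) := ⟨by linarith [hv.1, hv.2], hv.2⟩
  have hcn := cn_pos hk' hv'
  have hdn := dn_pos hk' v
  set c := dn v (compl k) / cn v (compl k) with hc
  have hc0 : 0 < c := by positivity
  have hd : ∀ t : ℝ, HasDerivAt (fun t => ellF k (Real.arctan (t / c)))
      (1 / √(1 - k ^ 2 * Real.sin (Real.arctan (t / c)) ^ 2) *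
        (1 / (1 + (t / c) ^ 2) * (1 / c))) t := fun t =>
    (hasDerivAt_ellF hk _).comp t (((hasDerivAt_id t).div_const c).arctan)
  have hinj : Function.Injective fun t => ellF k (Real.arctan (t / c)) := fun s t hst => by
    have := Real.arctan_injective ((strictMono_ellF hk).injective hst)
    field_simp at this
    exact this
  rw [intervalIntegral.integral_of_le (by linarith [ellK_pos hk]), integral_Ioc_eq_integral_Ioo,
    ← image_ellF_arctan hk hc0,
    integral_image_eq_integral_abs_deriv_smul MeasurableSet.univ
      (fun t _ => (hd t).hasDerivWithinAt) hinj.injOn, setIntegral_univ]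
  congr 1
  funext t
  rw [Complex.real_smul, ← mul_assoc, ← Complex.ofReal_mul]
  congr 2
  set W := dn (ellF k (Real.arctan (t / c))) k with hW
  have hWr : √(1 - k ^ 2 * Real.sin (Real.arctan (t / c)) ^ 2) = W := by
    rw [hW, dn, sn, am_ellF hk]
  have hW0 : 0 < W := dn_pos hk _
  have hW2 : W ^ 2 = 1 - k ^ 2 * ((t / c) ^ 2 / (1 + (t / c) ^ 2)) := by
    rw [hW, dn_sq hk, sn, am_ellF hk, Real.sin_arctan, div_pow, Real.sq_sqrt (by positivity)]
  have hD := one_sub_dn_sq_mul_sn_sq_pos hk (ellF k (Real.arctan (t / c))) hv'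
  rw [← hW] at hD
  rw [hWr, abs_of_pos (by positivity)]
  have hx : t = c * (t / c) := by field_simp
  -- The choice of c makes the kernel's denominator proportional to (1+t²)/(1+(t/c)²); the
  -- Jacobian's 1+(t/c)² then cancels.
  have hD2 : (1 - W ^ 2 * sn v (compl k) ^ 2) * (1 + (t / c) ^ 2) =
      cn v (compl k) ^ 2 * (1 + t ^ 2) := by
    have e1 : cn v (compl k) ^ 2 = 1 - sn v (compl k) ^ 2 := by
      linarith [sn_sq_add_cn_sq (k := compl k) v]
    have e2 : c ^ 2 * cn v (compl k) ^ 2 = 1 - compl k ^ 2 * sn v (compl k) ^ 2 := by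
      rw [← dn_sq hk', hc]
      field_simp
    rw [compl_sq hk] at e2
    generalize t / c = x at *
    have hx0 : 1 + x ^ 2 ≠ 0 := by positivity
    rw [hW2, hx]
    field_simp
    linear_combination (-(x ^ 2)) * e2 - e1
  have hdc : dn v (compl k) = c * cn v (compl k) := by rw [hc]; field_simp
  rw [hdc]
  have h1 : 1 + (t / c) ^ 2 ≠ 0 := by positivity
  have h2 : 1 + t ^ 2 ≠ 0 := by positivity
  generalize t / c = x at *
  field_simp
  linear_combination (-sn v (compl k)) * hD2

/-- As v → K', cn(v; k') → 0, so c → ∞ and each t corresponds to a point u → 0. Dominated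
convergence with bound 1/(1+t²), of integral π, gives π g(0). -/
theorem tendsto_integral_kernel (hk : k ∈ Ioo (0 : ℝ) 1) {g : ℝ → ℂ} (hg : Continuous g)
    (hb : ∀ u, ‖g u‖ ≤ 1) :
    Tendsto (fun v => ∫ u in (-ellK k)..ellK k,
      ((dn u k ^ 2 * (sn v (compl k) * cn v (compl k) * dn v (compl k)) /
        (1 - dn u k ^ 2 * sn v (compl k) ^ 2) : ℝ) : ℂ) * g u)
      (𝓝[<] ellK (compl k)) (𝓝 (Real.pi * g 0)) := by
  have hk' := compl_mem hk
  have hK' := ellK_pos hk'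
  have hmem : Ioo 0 (ellK (compl k)) ∈ 𝓝[<] ellK (compl k) := Ioo_mem_nhdsLT hK'
  refine Tendsto.congr' (f₁ := fun v => ∫ t : ℝ, ((sn v (compl k) * dn (ellF k (Real.arctan
        (t / (dn v (compl k) / cn v (compl k))))) k * (1 + t ^ 2)⁻¹ : ℝ) : ℂ) *
      g (ellF k (Real.arctan (t / (dn v (compl k) / cn v (compl k)))))) ?_ ?_
  · filter_upwards [hmem] with v hv using (integral_kernel_eq hk hv g).symm
  have hlim : (Real.pi * g 0 : ℂ) = ∫ t : ℝ, (((1 + t ^ 2)⁻¹ : ℝ) : ℂ) * g 0 := by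
    rw [integral_mul_const, integral_complex_ofReal, integral_univ_inv_one_add_sq]
  have hF := continuous_ellF hk
  have hdn := continuous_dn hk
  rw [hlim]
  refine tendsto_integral_filter_of_dominated_convergence (fun t : ℝ => (1 + t ^ 2)⁻¹) ?_ ?_
    integrable_inv_one_add_sq ?_
  · refine Eventually.of_forall fun v => Continuous.aestronglyMeasurable ?_
    have h1 : Continuous fun t : ℝ => (1 + t ^ 2)⁻¹ :=
      Continuous.inv₀ (by fun_prop) fun t => by positivity
    have h2 : Continuous fun t : ℝ => ellF k (Real.arctan
        (t / (dn v (compl k) / cn v (compl k)))) :=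
      hF.comp (Real.continuous_arctan.comp (by fun_prop))
    exact (Complex.continuous_ofReal.comp
      ((continuous_const.mul (hdn.comp h2)).mul h1)).mul (hg.comp h2)
  · refine Eventually.of_forall fun v => Eventually.of_forall fun t => ?_
    rw [norm_mul, Complex.norm_real, norm_mul, norm_mul, Real.norm_eq_abs, Real.norm_eq_abs,
      Real.norm_eq_abs]
    have h1 : |sn v (compl k)| ≤ 1 := Real.abs_sin_le_one _
    have h2 := dn_le_one (k := k) (ellF k (Real.arctan (t / (dn v (compl k) / cn v (compl k)))))
    have h3 := dn_pos hk (ellF k (Real.arctan (t / (dn v (compl k) / cn v (compl k)))))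
    have h4 : (0 : ℝ) < (1 + t ^ 2)⁻¹ := by positivity
    rw [abs_of_pos h3, abs_of_pos h4]
    have h5 := mul_le_one₀ h1 h3.le h2
    have h6 := mul_le_of_le_one_left h4.le h5
    have := hb (ellF k (Real.arctan (t / (dn v (compl k) / cn v (compl k)))))
    exact (mul_le_of_le_one_right (by positivity) this).trans h6
  · refine Eventually.of_forall fun t => ?_
    have hcn : Tendsto (fun v => t / (dn v (compl k) / cn v (compl k)))
        (𝓝[<] ellK (compl k)) (𝓝 0) := by
      have h1 : ContinuousAt (fun v => t * cn v (compl k) / dn v (compl k)) (ellK (compl k)) :=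
        ((continuous_const.mul (continuous_cn hk')).div₀ (continuous_dn hk')
          fun v => (dn_pos hk' v).ne').continuousAt
      have h2 := h1.tendsto.mono_left (nhdsWithin_le_nhds (s := Iio (ellK (compl k))))
      simp only [cn_ellK hk', mul_zero, zero_div] at h2
      refine h2.congr fun v => ?_
      rw [div_div_eq_mul_div]
    have hu : Tendsto (fun v => ellF k (Real.arctan (t / (dn v (compl k) / cn v (compl k)))))
        (𝓝[<] ellK (compl k)) (𝓝 0) := by
      have := ((hF.comp Real.continuous_arctan).tendsto 0).comp hcn
      simp only [Function.comp_apply, Real.arctan_zero, ellF_zero] at this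
      exact this
    have hs : Tendsto (fun v => sn v (compl k)) (𝓝[<] ellK (compl k)) (𝓝 1) := by
      have := (continuous_sn hk').tendsto (ellK (compl k))
      rw [sn_ellK hk'] at this
      exact this.mono_left nhdsWithin_le_nhds
    have hd : Tendsto (fun v => dn (ellF k (Real.arctan
        (t / (dn v (compl k) / cn v (compl k))))) k) (𝓝[<] ellK (compl k)) (𝓝 1) := by
      have := (hdn.tendsto 0).comp hu
      rwa [dn_zero hk] at this
    have h := ((Complex.continuous_ofReal.tendsto _).comp
      ((hs.mul hd).mul_const ((1 + t ^ 2)⁻¹))).mul ((hg.tendsto 0).comp hu)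
    rw [one_mul, one_mul] at h
    exact h

/-- The kernel contributes π for every n. The part of Im Z that is constant in u affects only n = 0,
where it removes exactly π. -/
theorem tendsto_periodIntegral_zetaIm (hk : k ∈ Ioo (0 : ℝ) 1) (n : ℤ) :
    Tendsto (fun v => periodIntegral k (fun u => zetaIm k u v) n) (𝓝[<] ellK (compl k))
      (𝓝 (if n = 0 then 0 else (Real.pi : ℂ))) := by
  have hk' := compl_mem hk
  have hK := ellK_pos hk
  have hK' := ellK_pos hk'
  set e := expI (n * Real.pi / ellK k) with he
  have hec : Continuous e := continuous_expI _
  have h1 := tendsto_integral_kernel hk hec fun u => (norm_expI _ u).le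
  have he0 : e 0 = 1 := by simp [he, expI]
  rw [he0, mul_one] at h1
  have h2 : Tendsto (fun v => ((zetaReal v (compl k) +
      Real.pi * v / (2 * ellK k * ellK (compl k)) : ℝ) : ℂ) * ∫ u in (-ellK k)..ellK k, e u)
      (𝓝[<] ellK (compl k)) (𝓝 (if n = 0 then (Real.pi : ℂ) else 0)) := by
    have hc : Continuous fun v => ((zetaReal v (compl k) +
        Real.pi * v / (2 * ellK k * ellK (compl k)) : ℝ) : ℂ) * ∫ u in (-ellK k)..ellK k, e u :=
      (Complex.continuous_ofReal.comp ((continuous_zetaReal hk').add (by fun_prop))).mul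
        continuous_const
    have := (hc.tendsto (ellK (compl k))).mono_left
      (nhdsWithin_le_nhds (s := Iio (ellK (compl k))))
    convert this using 2
    split_ifs with hn
    · have : ∫ u in (-ellK k)..ellK k, e u = ((2 * ellK k : ℝ) : ℂ) := by
        simp [he, hn, expI]
        ring
      -- At v = K' the Zeta term vanishes and πv/(2KK') = π/(2K) is integrated over length 2K.
      rw [this, zetaReal_ellK hk', ← Complex.ofReal_mul]
      congr 1
      field_simp
      ring
    · rw [he, integral_expI hK hn, mul_zero]
  have h3 := h1.sub h2
  have h4 : (Real.pi : ℂ) - (if n = 0 then (Real.pi : ℂ) else 0) =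
      if n = 0 then 0 else (Real.pi : ℂ) := by split_ifs <;> simp
  rw [h4] at h3
  refine h3.congr' ?_
  filter_upwards [Ioo_mem_nhdsLT (show -ellK (compl k) < ellK (compl k) by linarith)] with v hv
  rw [periodIntegral, ← intervalIntegral.integral_const_mul, ← intervalIntegral.integral_sub]
  · congr 1
    funext u
    simp only [zetaIm]
    push_cast
    ring
  · refine Continuous.intervalIntegrable (Continuous.mul (Complex.continuous_ofReal.comp ?_) hec) _ _
    have hdn := continuous_dn hk
    exact Continuous.div₀ (by fun_prop) (by fun_prop) fun u =>
      (one_sub_dn_sq_mul_sn_sq_pos hk u hv).ne'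
  · exact (continuous_const.mul hec).intervalIntegrable _ _

/-! ### Explicit Fourier coefficients of Im Z and of its v-derivative. -/

theorem periodIntegral_zetaIm_eq_sinh (hk : k ∈ Ioo (0 : ℝ) 1) (n : ℤ) {v : ℝ}
    (hv : v ∈ Ioo (-ellK (compl k)) (ellK (compl k))) :
    periodIntegral k (fun u => zetaImV k u v) n =
      periodIntegral k (fun u => zetaImV k u 0) n * Real.cosh (n * Real.pi / ellK k * v) ∧
    (n * Real.pi / ellK k : ℝ) * periodIntegral k (fun u => zetaIm k u v) n =
      periodIntegral k (fun u => zetaImV k u 0) n * Real.sinh (n * Real.pi / ellK k * v) := by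
  refine eq_sinh_of_hasDerivAt (ellK_pos (compl_mem hk))
    (a := fun v => periodIntegral k (fun u => zetaIm k u v) n)
    (a' := fun v => periodIntegral k (fun u => zetaImV k u v) n) ?_ ?_ ?_ hv
  · intro w hw
    exact hasDerivAt_periodIntegral isOpen_Ioo (continuousOn_zetaIm hk) (continuousOn_zetaImV hk)
      (fun w hw u => hasDerivAt_zetaIm_right hk u hw) n hw
  · intro w hw
    rw [← periodIntegral_zetaImVV hk hw]
    exact hasDerivAt_periodIntegral isOpen_Ioo (continuousOn_zetaImV hk) (continuousOn_zetaImVV hk)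
      (fun w hw u => hasDerivAt_zetaImV_right hk u hw) n hw
  · simp [periodIntegral, zetaIm_zero hk]

/-- The Fourier coefficients of `Im Z(· + iv; k)` and of its `v`-derivative. -/
theorem periodIntegral_zetaIm (hk : k ∈ Ioo (0 : ℝ) 1) {v : ℝ}
    (hv : v ∈ Ioo (-ellK (compl k)) (ellK (compl k))) {n : ℤ} (hn : n ≠ 0) :
    periodIntegral k (fun u => zetaIm k u v) n =
      ((Real.pi * (Real.sinh (n * Real.pi / ellK k * v) /
        Real.sinh (n * Real.pi / ellK k * ellK (compl k))) : ℝ) : ℂ) ∧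
    periodIntegral k (fun u => zetaImV k u v) n =
      ((Real.pi * (n * Real.pi / ellK k) * (Real.cosh (n * Real.pi / ellK k * v) /
        Real.sinh (n * Real.pi / ellK k * ellK (compl k))) : ℝ) : ℂ) := by
  have hK := ellK_pos hk
  have hK' := ellK_pos (compl_mem hk)
  set μ : ℝ := n * Real.pi / ellK k with hμ
  have hμ0 : μ ≠ 0 := by
    have : (n : ℝ) ≠ 0 := by exact_mod_cast hn
    have := Real.pi_ne_zero
    positivity
  have hμc : (μ : ℂ) ≠ 0 := by exact_mod_cast hμ0
  have hS : Real.sinh (μ * ellK (compl k)) ≠ 0 := by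
    rw [Ne, Real.sinh_eq_zero]
    positivity
  have hSc : (Real.sinh (μ * ellK (compl k)) : ℂ) ≠ 0 := by exact_mod_cast hS
  set A := periodIntegral k (fun u => zetaImV k u 0) n with hA
  have hl := tendsto_periodIntegral_zetaIm hk n
  rw [if_neg hn] at hl
  have hl2 : Tendsto (fun v => (μ : ℂ) * periodIntegral k (fun u => zetaIm k u v) n)
      (𝓝[<] ellK (compl k)) (𝓝 (A * Real.sinh (μ * ellK (compl k)))) := by
    have hc : Continuous fun v => A * (Real.sinh (μ * v) : ℂ) :=
      continuous_const.mul (Complex.continuous_ofReal.comp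
        (Real.continuous_sinh.comp (by fun_prop)))
    refine ((hc.tendsto (ellK (compl k))).mono_left nhdsWithin_le_nhds).congr' ?_
    filter_upwards [Ioo_mem_nhdsLT (show -ellK (compl k) < ellK (compl k) by linarith)] with w hw
    exact (periodIntegral_zetaIm_eq_sinh hk n hw).2.symm
  -- The unknown amplitude A is determined by comparing the sinh formula with the limit π at v = K'.
  have hAe := tendsto_nhds_unique hl2 (hl.const_mul (μ : ℂ))
  obtain ⟨h1, h2⟩ := periodIntegral_zetaIm_eq_sinh hk n hv
  rw [← hμ, ← hA] at h1 h2
  have hA2 : A = μ * Real.pi / Real.sinh (μ * ellK (compl k)) := by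
    rw [eq_div_iff hSc, hAe]
  constructor
  · apply mul_left_cancel₀ hμc
    rw [h2, hA2]
    push_cast
    ring
  · rw [h1, hA2]
    push_cast
    ring

/-- For n = 0 the sinh relation for the function itself degenerates to 0 = 0. The mean is instead
linear in v, vanishing at 0 and in the limit v → K', hence identically zero. -/
theorem periodIntegral_zetaIm_zero (hk : k ∈ Ioo (0 : ℝ) 1) {v : ℝ}
    (hv : v ∈ Ioo (-ellK (compl k)) (ellK (compl k))) :
    periodIntegral k (fun u => zetaIm k u v) 0 = 0 ∧
    periodIntegral k (fun u => zetaImV k u v) 0 = 0 := by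
  have hK' := ellK_pos (compl_mem hk)
  have h0 : (0 : ℝ) ∈ Ioo (-ellK (compl k)) (ellK (compl k)) := ⟨by linarith, hK'⟩
  set A := periodIntegral k (fun u => zetaImV k u 0) 0 with hA
  have hV : ∀ w ∈ Ioo (-ellK (compl k)) (ellK (compl k)),
      periodIntegral k (fun u => zetaImV k u w) 0 = A := fun w hw => by
    have := (periodIntegral_zetaIm_eq_sinh hk 0 hw).1
    simpa using this
  have hlin : ∀ w ∈ Ioo (-ellK (compl k)) (ellK (compl k)),
      periodIntegral k (fun u => zetaIm k u w) 0 = w * A := fun w hw => by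
    have hd : ∀ w ∈ Ioo (-ellK (compl k)) (ellK (compl k)), HasDerivAt
        (fun w : ℝ => periodIntegral k (fun u => zetaIm k u w) 0 - w * A) 0 w := fun w hw => by
      have h1 := hasDerivAt_periodIntegral (k := k) isOpen_Ioo (continuousOn_zetaIm hk)
        (continuousOn_zetaImV hk) (fun w hw u => hasDerivAt_zetaIm_right hk u hw) 0 hw
      refine (h1.fun_sub ((Complex.ofRealCLM.hasDerivAt (x := w)).mul_const A)).congr_deriv ?_
      rw [hV w hw]
      simp
    have := isOpen_Ioo.is_const_of_deriv_eq_zero isPreconnected_Ioo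
      (fun w hw => (hd w hw).differentiableAt.differentiableWithinAt)
      (fun w hw => (hd w hw).deriv) hw h0
    simp only [Complex.ofReal_zero, zero_mul, sub_zero] at this
    rw [sub_eq_iff_eq_add] at this
    rw [this]
    simp [periodIntegral, zetaIm_zero hk]
  have hl := tendsto_periodIntegral_zetaIm hk 0
  rw [if_pos rfl] at hl
  have hl2 : Tendsto (fun v => periodIntegral k (fun u => zetaIm k u v) 0)
      (𝓝[<] ellK (compl k)) (𝓝 (ellK (compl k) * A)) := by
    have hc : Continuous fun v : ℝ => (v : ℂ) * A := by fun_prop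
    refine ((hc.tendsto (ellK (compl k))).mono_left nhdsWithin_le_nhds).congr' ?_
    filter_upwards [Ioo_mem_nhdsLT (show -ellK (compl k) < ellK (compl k) by linarith)] with w hw
    exact (hlin w hw).symm
  have hA0 : A = 0 := by
    have := tendsto_nhds_unique hl2 hl
    rcases mul_eq_zero.mp this with h | h
    · exact absurd (by exact_mod_cast h) hK'.ne'
    · exact h
  rw [hlin v hv, hV v hv, hA0, mul_zero]
  exact ⟨rfl, rfl⟩

end ZetaFourier

/-! ### Exponential decay of the Fourier coefficients -/

section Decay

/-- The reverse triangle inequality for e^z - e^{-z}. -/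
theorem sinh_abs_re_le_norm_sinh (z : ℂ) : Real.sinh |z.re| ≤ ‖Complex.sinh z‖ := by
  have h1 : 2 * ‖Complex.sinh z‖ = ‖Complex.exp z - Complex.exp (-z)‖ := by
    rw [← Complex.two_sinh, norm_mul]
    simp
  have h2 := abs_norm_sub_norm_le (Complex.exp z) (Complex.exp (-z))
  rw [Complex.norm_exp, Complex.norm_exp, Complex.neg_re] at h2
  have h3 : Real.exp z.re - Real.exp (-z.re) = 2 * Real.sinh z.re := by
    rw [Real.sinh_eq]; ring
  rw [h3, abs_mul, abs_two, Real.abs_sinh] at h2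
  linarith

theorem cosh_le_exp_abs (x : ℝ) : Real.cosh x ≤ Real.exp |x| := by
  rw [← Real.cosh_abs, Real.cosh_eq]
  have : Real.exp (-|x|) ≤ Real.exp |x| :=
    Real.exp_le_exp.mpr (by linarith [abs_nonneg x])
  linarith

theorem exp_mul_le_sinh {r t : ℝ} (ht : r ≤ t) :
    Real.exp t * ((1 - Real.exp (-(2 * r))) / 2) ≤ Real.sinh t := by
  have h1 : Real.exp t * Real.exp (-(2 * t)) = Real.exp (-t) := by
    rw [← Real.exp_add]; ring_nf
  have h2 : Real.exp (-(2 * t)) ≤ Real.exp (-(2 * r)) := Real.exp_le_exp.mpr (by linarith)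
  have h3 := mul_le_mul_of_nonneg_left h2 (Real.exp_pos t).le
  rw [Real.sinh_eq]
  linarith

/-- The decay of `cosh(md) / sinh(mz)` for `Re z ≥ r`. -/
theorem cosh_div_norm_sinh_le {d r : ℝ} (hd : 0 < d) (hr : 0 < r) {m : ℤ} (hm : m ≠ 0) {z : ℂ}
    (hz : r ≤ z.re) :
    Real.cosh (m * d) / ‖Complex.sinh (m * z)‖ ≤
      2 / (1 - Real.exp (-(2 * r))) * Real.exp (-(|(m : ℝ)| * (r - d))) := by
  have hm1 : (1 : ℝ) ≤ |(m : ℝ)| := by exact_mod_cast Int.one_le_abs hm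
  have he : 0 < 1 - Real.exp (-(2 * r)) := by
    have : Real.exp (-(2 * r)) < 1 := Real.exp_lt_one_iff.mpr (by linarith)
    linarith
  have h1 := sinh_abs_re_le_norm_sinh (m * z)
  have h2 : ((m : ℂ) * z).re = m * z.re := by simp
  rw [h2, abs_mul, abs_of_pos (hr.trans_le hz)] at h1
  have h3 : |(m : ℝ)| * r ≤ |(m : ℝ)| * z.re := by gcongr
  have h4 := exp_mul_le_sinh (r := r) (t := |(m : ℝ)| * z.re) (by nlinarith)
  have h5 := Real.exp_le_exp.mpr h3
  have h6 : Real.exp (|(m : ℝ)| * r) * ((1 - Real.exp (-(2 * r))) / 2) ≤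
      ‖Complex.sinh (m * z)‖ :=
    (mul_le_mul_of_nonneg_right h5 (by positivity)).trans (h4.trans h1)
  have h7 := cosh_le_exp_abs (m * d)
  rw [abs_mul, abs_of_pos hd] at h7
  refine (div_le_div₀ (Real.exp_pos _).le h7 (by positivity) h6).trans_eq ?_
  rw [show -(|(m : ℝ)| * (r - d)) = |(m : ℝ)| * d - |(m : ℝ)| * r by ring, Real.exp_sub]
  field_simp

theorem abs_sinh_le_cosh (x : ℝ) : |Real.sinh x| ≤ Real.cosh x := by
  rw [Real.abs_sinh, ← Real.cosh_abs]
  exact (Real.sinh_lt_cosh _).le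

theorem summable_pow_mul_exp_neg_abs (j : ℕ) {ε : ℝ} (hε : 0 < ε) :
    Summable fun m : ℤ => (1 + |(m : ℝ)|) ^ j * Real.exp (-(|(m : ℝ)| * ε)) := by
  have h : Summable fun m : ℕ => (1 + (m : ℝ)) ^ j * Real.exp (-((m : ℝ) * ε)) := by
    have h1 := (summable_nat_add_iff 1).mpr (Real.summable_pow_mul_exp_neg_nat_mul j hε)
    refine (h1.mul_right (Real.exp ε)).congr fun m => ?_
    rw [mul_assoc, ← Real.exp_add]
    push_cast
    congr 2 <;> ring
  refine Summable.of_nat_of_neg (h.congr fun m => ?_) (h.congr fun m => ?_) <;> simp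

end Decay

/-! ### Fourier series on the circle of length `L` -/

section FourierSeries

variable {L : ℝ}

theorem fourierCoeff_lift [Fact (0 < L)] {f : ℝ → ℂ} (hp : Function.Periodic f L) (n : ℤ) :
    fourierCoeff (T := L) hp.lift n = coeff L f n := by
  rw [fourierCoeff_eq_intervalIntegral _ n 0, coeff, zero_add, Complex.real_smul]
  push_cast
  congr 1
  refine intervalIntegral.integral_congr fun x _ => ?_
  rw [Function.Periodic.lift_coe, fourier_coe_apply, smul_eq_mul, mul_comm]
  congr 2
  push_cast
  ring

theorem continuous_lift {f : ℝ → ℂ} (hf : Continuous f) (hp : Function.Periodic f L) :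
    Continuous (hp.lift : AddCircle L → ℂ) :=
  continuous_coinduced_dom.mpr hf

theorem hasSum_coeff [Fact (0 < L)] {f : ℝ → ℂ} (hf : Continuous f) (hp : Function.Periodic f L)
    (hs : Summable (coeff L f)) (x : ℝ) :
    HasSum (fun n : ℤ => coeff L f n * Complex.exp (2 * Real.pi * Complex.I * n * x / L))
      (f x) := by
  have hc : fourierCoeff (T := L) (⟨hp.lift, continuous_lift hf hp⟩ : C(AddCircle L, ℂ)) =
      coeff L f := funext fun n => fourierCoeff_lift hp n
  have h := has_pointwise_sum_fourier_series_of_summable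
    (f := (⟨hp.lift, continuous_lift hf hp⟩ : C(AddCircle L, ℂ))) (by rwa [hc]) (x : AddCircle L)
  rw [hc] at h
  simpa only [ContinuousMap.coe_mk, Function.Periodic.lift_coe, fourier_coe_apply, smul_eq_mul]
    using h

end FourierSeries

/-! ### The profile as a rescaling of Im Z. -/

section Profile

variable {L δ k : ℝ}

/-- The Fourier coefficients of an `L`-periodic function obtained by rescaling a
`2K(k)`-periodic one. -/
theorem coeff_comp_mul (hL : 0 < L) (hk : k ∈ Ioo (0 : ℝ) 1) {g : ℝ → ℝ}
    (hp : Function.Periodic g (2 * ellK k)) (n : ℤ) :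
    coeff L (fun x => (g (2 * ellK k / L * x) : ℂ)) n =
      1 / (2 * ellK k : ℝ) * periodIntegral k g n := by
  have hK := ellK_pos hk
  have hLc : (L : ℂ) ≠ 0 := by exact_mod_cast hL.ne'
  have hKc : (ellK k : ℂ) ≠ 0 := by exact_mod_cast hK.ne'
  have hα : 2 * ellK k / L ≠ 0 := by positivity
  have hpe : Function.Periodic (fun u => (g u : ℂ) * expI (n * Real.pi / ellK k) u)
      (2 * ellK k) := fun u => by
    have : expI (n * Real.pi / ellK k) (u + 2 * ellK k) = expI (n * Real.pi / ellK k) u := by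
      rw [expI, expI, Complex.exp_eq_exp_iff_exists_int]
      refine ⟨-n, ?_⟩
      push_cast
      field_simp
      ring
    simp only [this, hp u]
  have h1 := intervalIntegral.integral_comp_mul_left (a := 0) (b := L)
    (fun u => (g u : ℂ) * expI (n * Real.pi / ellK k) u) hα
  have h2 := hpe.intervalIntegral_add_eq (-ellK k) 0
  rw [show -ellK k + 2 * ellK k = ellK k by ring, zero_add] at h2
  rw [mul_zero, div_mul_cancel₀ _ hL.ne', ← h2] at h1
  rw [coeff, periodIntegral]
  have h3 : ∫ x in (0 : ℝ)..L, (g (2 * ellK k / L * x) : ℂ) *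
      Complex.exp (-(2 * Real.pi * Complex.I * n * x / L)) =
      ∫ x in (0 : ℝ)..L, (g (2 * ellK k / L * x) : ℂ) *
        expI (n * Real.pi / ellK k) (2 * ellK k / L * x) := by
    congr 1
    funext x
    rw [expI]
    congr 2
    push_cast
    field_simp
  rw [h3, h1, Complex.real_smul]
  push_cast
  field_simp

/-- The arguments are u ∓ iv; Re Z is even and Im Z is odd in v, so the difference is -2i Im Z(u +
iv), and the prefactor i makes it real. -/
theorem profile_eq (hk : k ∈ Ioo (0 : ℝ) 1) (x : ℝ) :
    profile L δ k x = ((2 * (2 * ellK k / L) *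
      zetaIm k (2 * ellK k / L * x) (2 * ellK k / L * δ) : ℝ) : ℂ) := by
  have hk' := compl_mem hk
  have h1 : (2 * ellK k / L * (x - Complex.I * δ) : ℂ) =
      ((2 * ellK k / L * x : ℝ) : ℂ) + ((-(2 * ellK k / L * δ) : ℝ) : ℂ) * Complex.I := by
    push_cast
    ring
  have h2 : (2 * ellK k / L * (x + Complex.I * δ) : ℂ) =
      ((2 * ellK k / L * x : ℝ) : ℂ) + ((2 * ellK k / L * δ : ℝ) : ℂ) * Complex.I := by
    push_cast
    ring
  rw [profile, h1, h2]
  simp only [zeta, Complex.add_re, Complex.add_im, Complex.ofReal_re, Complex.ofReal_im,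
    Complex.re_ofReal_mul, Complex.im_ofReal_mul, Complex.I_re, Complex.I_im, mul_zero, mul_one,
    add_zero, zero_add, sn_neg hk', cn_neg hk', dn_neg hk', zetaReal_neg hk', neg_sq]
  generalize 2 * ellK k / L * δ = v
  generalize 2 * ellK k / L * x = u
  rw [zetaIm]
  have hI : Complex.I * Complex.I = -1 := Complex.I_mul_I
  push_cast
  ring_nf
  simp only [Complex.I_sq]
  ring

theorem mul_mem_of_vRatio_lt_one (hL : 0 < L) (hδ : 0 < δ) (hk : k ∈ Ioo (0 : ℝ) 1)
    (h : vRatio L δ k < 1) :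
    2 * ellK k / L * δ ∈ Ioo 0 (ellK (compl k)) := by
  have hK := ellK_pos hk
  have hK' := ellK_pos (compl_mem hk)
  refine ⟨by positivity, ?_⟩
  have : vRatio L δ k = 2 * ellK k / L * δ / ellK (compl k) := by
    rw [vRatio]; ring
  rwa [this, div_lt_one hK'] at h

end Profile

/-! ### The travelling wave equation -/

section Wave

variable {L δ k : ℝ}

theorem periodIntegral_const_mul (c : ℝ) (f : ℝ → ℝ) (n : ℤ) :
    periodIntegral k (fun u => c * f u) n = c * periodIntegral k f n := by
  simp only [periodIntegral, Complex.ofReal_mul, mul_assoc, intervalIntegral.integral_const_mul]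

theorem zetaImV_periodic (hk : k ∈ Ioo (0 : ℝ) 1) (v : ℝ) :
    Function.Periodic (fun u => zetaImV k u v) (2 * ellK k) := fun u => by
  simp only [zetaImV, dn_add_two_ellK hk]

theorem continuous_zetaIm (hk : k ∈ Ioo (0 : ℝ) 1) {v : ℝ}
    (hv : v ∈ Ioo (-ellK (compl k)) (ellK (compl k))) : Continuous fun u => zetaIm k u v :=
  continuousOn_univ.mp ((continuousOn_zetaIm hk).comp (f := fun u : ℝ => (v, u))
    (by fun_prop) fun _ _ => ⟨hv, mem_univ _⟩)

theorem continuous_zetaImV (hk : k ∈ Ioo (0 : ℝ) 1) {v : ℝ}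
    (hv : v ∈ Ioo (-ellK (compl k)) (ellK (compl k))) : Continuous fun u => zetaImV k u v :=
  continuousOn_univ.mp ((continuousOn_zetaImV hk).comp (f := fun u : ℝ => (v, u))
    (by fun_prop) fun _ _ => ⟨hv, mem_univ _⟩)

theorem mul_periodic (hL : 0 < L) {g : ℝ → ℝ}
    (hp : Function.Periodic g (2 * ellK k)) :
    Function.Periodic (fun x => (g (2 * ellK k / L * x) : ℂ)) L := fun x => by
  have : 2 * ellK k / L * (x + L) = 2 * ellK k / L * x + 2 * ellK k := by field_simp
  simp only [this, hp _]

/-- The function `T_δ ∂ₓ φ_k`. -/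
def profileFlux (L δ k x : ℝ) : ℝ :=
  2 * (2 * ellK k / L) ^ 2 * zetaImV k (2 * ellK k / L * x) (2 * ellK k / L * δ)

/-- For n ≠ 0 the modulus enters only through πK(k')/K(k), on which the smooth dependence on k
rests. -/
theorem coeff_profile (hL : 0 < L) (hδ : 0 < δ) (hk : k ∈ Ioo (0 : ℝ) 1)
    (h : vRatio L δ k < 1) (n : ℤ) :
    coeff L (profile L δ k) n = ((if n = 0 then 0 else 2 * Real.pi / L *
      (Real.sinh (n * (2 * Real.pi * δ / L)) /
        Real.sinh (n * (Real.pi * ellK (compl k) / ellK k))) : ℝ) : ℂ) := by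
  have hK := ellK_pos hk
  have hv := mul_mem_of_vRatio_lt_one hL hδ hk h
  have hv' : 2 * ellK k / L * δ ∈ Ioo (-ellK (compl k)) (ellK (compl k)) :=
    ⟨by linarith [hv.1, hv.2], hv.2⟩
  rw [funext fun x => profile_eq (δ := δ) (L := L) hk x,
    coeff_comp_mul (g := fun u => 2 * (2 * ellK k / L) * zetaIm k u (2 * ellK k / L * δ)) hL hk
      (fun u => by simp only [zetaIm_periodic hk _ u]) n, periodIntegral_const_mul]
  split_ifs with hn
  · rw [hn, (periodIntegral_zetaIm_zero hk hv').1]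
    simp
  · rw [(periodIntegral_zetaIm hk hv' hn).1, ← Complex.ofReal_one, ← Complex.ofReal_div,
      ← Complex.ofReal_mul, ← Complex.ofReal_mul]
    congr 1
    rw [show n * Real.pi / ellK k * (2 * ellK k / L * δ) = n * (2 * Real.pi * δ / L) by field_simp,
      show n * Real.pi / ellK k * ellK (compl k) = n * (Real.pi * ellK (compl k) / ellK k) by ring]
    field_simp

theorem coeff_profileFlux (hL : 0 < L) (hδ : 0 < δ) (hk : k ∈ Ioo (0 : ℝ) 1)
    (h : vRatio L δ k < 1) (n : ℤ) :
    coeff L (fun x => (profileFlux L δ k x : ℂ)) n = ((if n = 0 then 0 else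
      2 * Real.pi / L * (2 * Real.pi * n / L) *
      (Real.cosh (n * (2 * Real.pi * δ / L)) /
        Real.sinh (n * (Real.pi * ellK (compl k) / ellK k))) : ℝ) : ℂ) := by
  have hK := ellK_pos hk
  have hv := mul_mem_of_vRatio_lt_one hL hδ hk h
  have hv' : 2 * ellK k / L * δ ∈ Ioo (-ellK (compl k)) (ellK (compl k)) :=
    ⟨by linarith [hv.1, hv.2], hv.2⟩
  unfold profileFlux
  rw [coeff_comp_mul (g := fun u => 2 * (2 * ellK k / L) ^ 2 * zetaImV k u (2 * ellK k / L * δ))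
    hL hk (fun u => by simp only [zetaImV_periodic hk _ u]) n, periodIntegral_const_mul]
  split_ifs with hn
  · rw [hn, (periodIntegral_zetaIm_zero hk hv').2]
    simp
  · rw [(periodIntegral_zetaIm hk hv' hn).2, ← Complex.ofReal_one, ← Complex.ofReal_div,
      ← Complex.ofReal_mul, ← Complex.ofReal_mul]
    congr 1
    rw [show n * Real.pi / ellK k * (2 * ellK k / L * δ) = n * (2 * Real.pi * δ / L) by field_simp,
      show n * Real.pi / ellK k * ellK (compl k) = n * (Real.pi * ellK (compl k) / ellK k) by ring]
    field_simp

theorem lt_of_vRatio_lt_one (hL : 0 < L) (hk : k ∈ Ioo (0 : ℝ) 1)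
    (h : vRatio L δ k < 1) :
    2 * Real.pi * δ / L < Real.pi * ellK (compl k) / ellK k := by
  have hK := ellK_pos hk
  have hK' := ellK_pos (compl_mem hk)
  have e : vRatio L δ k = 2 * δ * ellK k / (L * ellK (compl k)) := by
    rw [vRatio]
    field_simp
  rw [e, div_lt_one (by positivity)] at h
  rw [div_lt_div_iff₀ hL hK]
  nlinarith [Real.pi_pos]

theorem summable_cosh_div_sinh {d ρ : ℝ} (hd : 0 < d) (hdr : d < ρ) (j : ℕ) :
    Summable fun n : ℤ => (1 + |(n : ℝ)|) ^ j * (if n = 0 then 0 else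
      |Real.cosh (n * d) / Real.sinh (n * ρ)|) := by
  have hr : 0 < ρ := hd.trans hdr
  refine Summable.of_nonneg_of_le (fun n => by positivity) (fun n => ?_)
    ((summable_pow_mul_exp_neg_abs j (sub_pos.mpr hdr)).mul_left (2 / (1 - Real.exp (-(2 * ρ)))))
  have he : 0 < 1 - Real.exp (-(2 * ρ)) := by
    have : Real.exp (-(2 * ρ)) < 1 := Real.exp_lt_one_iff.mpr (by linarith)
    linarith
  split_ifs with hn
  · rw [mul_zero]
    positivity
  · have := cosh_div_norm_sinh_le hd hr hn (z := (ρ : ℂ)) (by simp)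
    rw [show ((n : ℂ) * ρ) = ((n * ρ : ℝ) : ℂ) by push_cast; ring, ← Complex.ofReal_sinh,
      Complex.norm_real, Real.norm_eq_abs] at this
    rw [abs_div, abs_of_pos (Real.cosh_pos _), mul_left_comm]
    gcongr

theorem summable_coeff_profile (hL : 0 < L) (hδ : 0 < δ) (hk : k ∈ Ioo (0 : ℝ) 1)
    (h : vRatio L δ k < 1) : Summable (coeff L (profile L δ k)) := by
  have hs := (summable_cosh_div_sinh (by positivity : 0 < 2 * Real.pi * δ / L)
    (lt_of_vRatio_lt_one hL hk h) 0).mul_left (2 * Real.pi / L)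
  refine Summable.of_norm_bounded hs fun n => ?_
  rw [coeff_profile hL hδ hk h, Complex.norm_real, pow_zero, one_mul]
  split_ifs
  · simp
  · rw [Real.norm_eq_abs, abs_mul, abs_of_pos (by positivity : 0 < 2 * Real.pi / L), abs_div,
      abs_div, abs_of_pos (Real.cosh_pos _)]
    gcongr
    exact abs_sinh_le_cosh _

theorem summable_coeff_profileFlux (hL : 0 < L) (hδ : 0 < δ) (hk : k ∈ Ioo (0 : ℝ) 1)
    (h : vRatio L δ k < 1) : Summable (coeff L fun x => (profileFlux L δ k x : ℂ)) := by
  have hs := (summable_cosh_div_sinh (by positivity : 0 < 2 * Real.pi * δ / L)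
    (lt_of_vRatio_lt_one hL hk h) 1).mul_left (2 * Real.pi / L * (2 * Real.pi / L))
  refine Summable.of_norm_bounded hs fun n => ?_
  rw [coeff_profileFlux hL hδ hk h, Complex.norm_real, pow_one]
  split_ifs
  · simp
  · have h1 : 2 * Real.pi / L * (2 * Real.pi * n / L) = 2 * Real.pi / L * (2 * Real.pi / L) * n := by
      ring
    rw [h1, Real.norm_eq_abs, abs_mul, abs_mul,
      abs_of_pos (by positivity : 0 < 2 * Real.pi / L * (2 * Real.pi / L)), mul_assoc]
    gcongr
    linarith

/-- For n ≠ 0 the coth in the symbol replaces sinh by cosh. For n = 0 both coefficients vanish, in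
agreement with θ(0) = 0. -/
theorem symbol_mul_coeff_profile (hL : 0 < L) (hδ : 0 < δ) (hk : k ∈ Ioo (0 : ℝ) 1)
    (h : vRatio L δ k < 1) (n : ℤ) :
    (symbol L δ n : ℂ) * coeff L (profile L δ k) n =
      coeff L (fun x => (profileFlux L δ k x : ℂ)) n - 1 / δ * coeff L (profile L δ k) n := by
  rw [coeff_profile hL hδ hk h, coeff_profileFlux hL hδ hk h, symbol]
  split_ifs with hn
  · simp
  · have hn' : (n : ℝ) ≠ 0 := by exact_mod_cast hn
    have hS : Real.sinh (n * (2 * Real.pi * δ / L)) ≠ 0 := by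
      rw [Ne, Real.sinh_eq_zero]
      positivity
    rw [show 2 * Real.pi * n * δ / L = n * (2 * Real.pi * δ / L) by ring]
    have : (1 / δ : ℂ) = ((1 / δ : ℝ) : ℂ) := by push_cast; rfl
    rw [this, ← Complex.ofReal_mul, ← Complex.ofReal_mul, ← Complex.ofReal_sub]
    congr 1
    rw [sub_mul]
    congr 1
    generalize Real.sinh (n * (Real.pi * ellK (compl k) / ellK k)) = T
    field_simp

theorem continuous_profile (hL : 0 < L) (hδ : 0 < δ) (hk : k ∈ Ioo (0 : ℝ) 1)
    (h : vRatio L δ k < 1) : Continuous (profile L δ k) := by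
  have hv := mul_mem_of_vRatio_lt_one hL hδ hk h
  rw [funext fun x => profile_eq (δ := δ) (L := L) hk x]
  have := continuous_zetaIm hk (v := 2 * ellK k / L * δ) ⟨by linarith [hv.1, hv.2], hv.2⟩
  fun_prop

theorem continuous_profileFlux (hL : 0 < L) (hδ : 0 < δ) (hk : k ∈ Ioo (0 : ℝ) 1)
    (h : vRatio L δ k < 1) : Continuous fun x => (profileFlux L δ k x : ℂ) := by
  have hv := mul_mem_of_vRatio_lt_one hL hδ hk h
  have := continuous_zetaImV hk (v := 2 * ellK k / L * δ) ⟨by linarith [hv.1, hv.2], hv.2⟩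
  unfold profileFlux
  fun_prop

theorem profile_periodic (hL : 0 < L) (hk : k ∈ Ioo (0 : ℝ) 1) :
    Function.Periodic (profile L δ k) L := by
  rw [funext fun x => profile_eq (δ := δ) (L := L) hk x]
  exact mul_periodic hL (g := fun u => 2 * (2 * ellK k / L) * zetaIm k u (2 * ellK k / L * δ))
    fun u => by simp only [zetaIm_periodic hk _ u]

theorem profileFlux_periodic (hL : 0 < L) (hk : k ∈ Ioo (0 : ℝ) 1) :
    Function.Periodic (fun x => (profileFlux L δ k x : ℂ)) L :=
  mul_periodic hL
    (g := fun u => 2 * (2 * ellK k / L) ^ 2 * zetaImV k u (2 * ellK k / L * δ))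
    fun u => by simp only [zetaImV_periodic hk _ u]

theorem profile_even (hk : k ∈ Ioo (0 : ℝ) 1) : Function.Even (profile L δ k) := fun x => by
  rw [profile_eq hk, profile_eq hk]
  simp only [mul_neg, zetaIm, dn_neg hk]

theorem hasSum_dispersionTerm (hL : 0 < L) (hδ : 0 < δ) (hk : k ∈ Ioo (0 : ℝ) 1)
    (h : vRatio L δ k < 1) (x : ℝ) :
    HasSum (dispersionTerm L δ (profile L δ k) x)
      (profileFlux L δ k x - 1 / δ * profile L δ k x) := by
  have : Fact (0 < L) := ⟨hL⟩
  have h1 := hasSum_coeff (continuous_profileFlux hL hδ hk h) (profileFlux_periodic hL hk)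
    (summable_coeff_profileFlux hL hδ hk h) x
  have h2 := (hasSum_coeff (continuous_profile hL hδ hk h) (profile_periodic hL hk)
    (summable_coeff_profile hL hδ hk h) x).mul_left (1 / δ : ℂ)
  have e : dispersionTerm L δ (profile L δ k) x = fun n => coeff L
      (fun x => (profileFlux L δ k x : ℂ)) n * Complex.exp (2 * Real.pi * Complex.I * n * x / L) -
      1 / δ * (coeff L (profile L δ k) n *
        Complex.exp (2 * Real.pi * Complex.I * n * x / L)) := funext fun n => by
    rw [dispersionTerm, symbol_mul_coeff_profile hL hδ hk h]
    ring
  rw [e]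
  exact h1.sub h2

/-- The quadratic identity behind the travelling wave equation. -/
theorem zetaIm_sq_identity (hk : k ∈ Ioo (0 : ℝ) 1) {v : ℝ} (hv : v ∈ Ioo 0 (ellK (compl k))) :
    ∃ B : ℝ, ∀ u, zetaIm k u v ^ 2 - zetaImV k u v / 2 +
      (zetaReal (2 * v) (compl k) + Real.pi * (2 * v) / (2 * ellK k * ellK (compl k)) +
        cn (2 * v) (compl k) * dn (2 * v) (compl k) / sn (2 * v) (compl k)) * zetaIm k u v = B := by
  have hk' := compl_mem hk
  have hK := ellK_pos hk
  have hK' := ellK_pos hk'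
  have hv' : v ∈ Ioo (-ellK (compl k)) (ellK (compl k)) := ⟨by linarith [hv.1], hv.2⟩
  have hs : 0 < sn v (compl k) := sn_pos hk' ⟨hv.1, by linarith [hv.2]⟩
  have hc := cn_pos hk' hv'
  have hd := dn_pos hk' v
  have hS : sn v (compl k) * cn v (compl k) * dn v (compl k) ≠ 0 := by positivity
  have key := zetaReal_two_mul_add hk' hS
  have e : (sn v (compl k) * cn v (compl k) * dn v (compl k)) ^ 2 =
      sn v (compl k) ^ 2 * (1 - sn v (compl k) ^ 2) * (1 - compl k ^ 2 * sn v (compl k) ^ 2) := by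
    rw [← dn_sq hk', ← sn_sq_add_cn_sq (k := compl k) v]
    ring
  have hC : zetaReal (2 * v) (compl k) + Real.pi * (2 * v) / (2 * ellK k * ellK (compl k)) +
      cn (2 * v) (compl k) * dn (2 * v) (compl k) / sn (2 * v) (compl k) =
      2 * (zetaReal v (compl k) + Real.pi * v / (2 * ellK k * ellK (compl k))) +
      (1 - 2 * (1 + compl k ^ 2) * sn v (compl k) ^ 2 + 3 * compl k ^ 2 * sn v (compl k) ^ 4) /
        (2 * (sn v (compl k) * cn v (compl k) * dn v (compl k))) := by
    linear_combination key
  rw [hC]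
  set R := zetaReal v (compl k) + Real.pi * v / (2 * ellK k * ellK (compl k)) with hR
  set P := 1 - 2 * (1 + compl k ^ 2) * sn v (compl k) ^ 2 + 3 * compl k ^ 2 * sn v (compl k) ^ 4
    with hP
  -- Put q = XS/D, so that Im Z = q - R. The constant is the expression at X = 0; otherwise q²
  -- cancels against half of 2X²S²/D², the terms 2Rq cancel, and P/(2S)·q cancels XP/(2D).
  refine ⟨R ^ 2 + (1 - compl k ^ 2 * sn v (compl k) ^ 2 - ellE (compl k) / ellK (compl k) +
    Real.pi / (2 * ellK k * ellK (compl k))) / 2 - (2 * R + P /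
      (2 * (sn v (compl k) * cn v (compl k) * dn v (compl k)))) * R, fun u => ?_⟩
  have hD := (one_sub_dn_sq_mul_sn_sq_pos hk u hv').ne'
  have h1 : zetaIm k u v = dn u k ^ 2 * (sn v (compl k) * cn v (compl k) * dn v (compl k)) /
      (1 - dn u k ^ 2 * sn v (compl k) ^ 2) - R := by
    rw [zetaIm, hR]
    ring
  have h2 : zetaImV k u v = dn u k ^ 2 * P / (1 - dn u k ^ 2 * sn v (compl k) ^ 2) +
      2 * (dn u k ^ 2) ^ 2 * (sn v (compl k) * cn v (compl k) * dn v (compl k)) ^ 2 /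
        (1 - dn u k ^ 2 * sn v (compl k) ^ 2) ^ 2 -
      (1 - compl k ^ 2 * sn v (compl k) ^ 2 - ellE (compl k) / ellK (compl k) +
    Real.pi / (2 * ellK k * ellK (compl k))) := by
    simp only [zetaImV, e, hP]
    ring
  rw [h1, h2]
  generalize (1 - compl k ^ 2 * sn v (compl k) ^ 2 - ellE (compl k) / ellK (compl k) +
    Real.pi / (2 * ellK k * ellK (compl k))) = R'
  generalize sn v (compl k) * cn v (compl k) * dn v (compl k) = S at *
  generalize 1 - dn u k ^ 2 * sn v (compl k) ^ 2 = D at *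
  generalize dn u k ^ 2 = X
  field_simp
  ring

theorem speed_eq (hL : 0 < L) (hk : k ∈ Ioo (0 : ℝ) 1) :
    speed L δ k = 1 / δ - 2 * (2 * ellK k / L) *
      (zetaReal (2 * (2 * ellK k / L * δ)) (compl k) +
        Real.pi * (2 * (2 * ellK k / L * δ)) / (2 * ellK k * ellK (compl k)) +
        cn (2 * (2 * ellK k / L * δ)) (compl k) * dn (2 * (2 * ellK k / L * δ)) (compl k) /
          sn (2 * (2 * ellK k / L * δ)) (compl k)) := by
  have hK := ellK_pos hk
  have hK' := ellK_pos (compl_mem hk)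
  rw [speed, show 4 * δ * ellK k / L = 2 * (2 * ellK k / L * δ) by ring]
  generalize 1 / δ = δ'
  generalize zetaReal (2 * (2 * ellK k / L * δ)) (compl k) = Z
  generalize cn (2 * (2 * ellK k / L * δ)) (compl k) * dn (2 * (2 * ellK k / L * δ)) (compl k) /
          sn (2 * (2 * ellK k / L * δ)) (compl k) = W
  field_simp
  ring

theorem wave_equation (hL : 0 < L) (hδ : 0 < δ) (hk : k ∈ Ioo (0 : ℝ) 1)
    (h : vRatio L δ k < 1) (x : ℝ) :
    -(speed L δ k : ℂ) * profile L δ k x + profile L δ k x ^ 2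
        - dispersion L δ (profile L δ k) x
      = 1 / (L : ℂ) * ∫ y in (0 : ℝ)..L, profile L δ k y ^ 2 := by
  have hLc : (L : ℂ) ≠ 0 := by exact_mod_cast hL.ne'
  obtain ⟨B, hB⟩ := zetaIm_sq_identity hk (mul_mem_of_vRatio_lt_one hL hδ hk h)
  -- This is `hB` multiplied by 4α² with α = 2K/L, the coefficient of φ_k being read off from
  -- `speed_eq`.
  have hsq : ∀ x, profile L δ k x ^ 2 = (4 * (2 * ellK k / L) ^ 2 * B : ℝ) +
      profileFlux L δ k x + (speed L δ k - 1 / δ : ℂ) * profile L δ k x := fun x => by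
    rw [profile_eq hk, profileFlux, speed_eq hL hk, ← hB (2 * ellK k / L * x)]
    push_cast
    ring
  have hint : ∀ f : ℝ → ℂ, coeff L f 0 = 0 → ∫ y in (0 : ℝ)..L, f y = 0 := fun f hf => by
    simpa [coeff, hLc] using hf
  have h1 := hint _ (by rw [coeff_profile hL hδ hk h]; simp)
  have h2 := hint _ (by rw [coeff_profileFlux hL hδ hk h 0]; simp)
  have hc1 := continuous_profile hL hδ hk h
  have hc2 := continuous_profileFlux hL hδ hk h
  have hA : 1 / (L : ℂ) * ∫ y in (0 : ℝ)..L, profile L δ k y ^ 2 =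
      (4 * (2 * ellK k / L) ^ 2 * B : ℝ) := by
    simp only [hsq]
    rw [intervalIntegral.integral_add, intervalIntegral.integral_add,
      intervalIntegral.integral_const_mul, h1, h2,
      intervalIntegral.integral_const, sub_zero, Complex.real_smul]
    · field_simp
      ring
    all_goals exact Continuous.intervalIntegrable (by fun_prop) _ _
  rw [hA, dispersion, (hasSum_dispersionTerm hL hδ hk h x).tsum_eq, hsq]
  ring

end Wave

/-! ### Dependence of the complete elliptic integral on the modulus -/

section Modulus

open Filter Topology

theorem one_sub_sq_mul_sin_sq_mem_slitPlane {z : ℂ} (hz : z ∈ Metric.ball (0 : ℂ) 1) (θ : ℝ) :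
    1 - z ^ 2 * (Real.sin θ : ℂ) ^ 2 ∈ Complex.slitPlane := by
  left
  have h1 : ‖z ^ 2 * (Real.sin θ : ℂ) ^ 2‖ < 1 := by
    rw [mem_ball_zero_iff] at hz
    have h2 : |Real.sin θ| ≤ 1 := Real.abs_sin_le_one θ
    rw [norm_mul, norm_pow, norm_pow, Complex.norm_real, Real.norm_eq_abs]
    have h3 : ‖z‖ ^ 2 < 1 := by nlinarith [norm_nonneg z]
    have h4 : |Real.sin θ| ^ 2 ≤ 1 := by nlinarith [abs_nonneg (Real.sin θ)]
    nlinarith [sq_nonneg |Real.sin θ|, sq_nonneg ‖z‖]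
  have h2 := Complex.re_le_norm (z ^ 2 * (Real.sin θ : ℂ) ^ 2)
  rw [Complex.sub_re, Complex.one_re]
  linarith

/-- The complete elliptic integral of the first kind for complex moduli in the unit disc. -/
def complexEllK (z : ℂ) : ℂ :=
  ∫ θ in (0 : ℝ)..(Real.pi / 2), (1 - z ^ 2 * (Real.sin θ : ℂ) ^ 2) ^ (-(1 / 2) : ℂ)

theorem differentiableOn_complexEllK : DifferentiableOn ℂ complexEllK (Metric.ball 0 1) := by
  intro z hz
  have hb : Continuous fun p : ℂ × ℝ => 1 - p.1 ^ 2 * (Real.sin p.2 : ℂ) ^ 2 := by fun_prop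
  have h := hasDerivAt_intervalIntegral_of_continuousOn (𝕜 := ℂ) (a := 0) (b := Real.pi / 2)
    (U := Metric.ball (0 : ℂ) 1)
    (F := fun z θ => (1 - z ^ 2 * (Real.sin θ : ℂ) ^ 2) ^ (-(1 / 2) : ℂ))
    (F' := fun z θ => (-(1 / 2) : ℂ) * (1 - z ^ 2 * (Real.sin θ : ℂ) ^ 2) ^ (-(1 / 2) - 1 : ℂ) *
      -(2 * z * (Real.sin θ : ℂ) ^ 2)) Metric.isOpen_ball ?_ ?_ ?_ hz
  · exact h.differentiableAt.differentiableWithinAt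
  · exact hb.continuousOn.cpow continuousOn_const
      fun p hp => one_sub_sq_mul_sin_sq_mem_slitPlane hp.1 p.2
  · refine (continuousOn_const.mul (hb.continuousOn.cpow continuousOn_const
      fun p hp => one_sub_sq_mul_sin_sq_mem_slitPlane hp.1 p.2)).mul ?_
    exact Continuous.continuousOn (by fun_prop)
  · intro w hw θ
    refine HasDerivAt.cpow_const ?_ (one_sub_sq_mul_sin_sq_mem_slitPlane hw θ)
    refine (((hasDerivAt_pow 2 w).mul_const _).const_sub 1).congr_deriv ?_
    norm_num

theorem complexEllK_ofReal {k : ℝ} (hk : k ∈ Ioo (0 : ℝ) 1) : complexEllK k = ellK k := by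
  rw [complexEllK, ellK, ellF, ← intervalIntegral.integral_ofReal]
  congr 1
  funext θ
  have h := one_sub_sq_mul_sin_sq_pos hk θ
  rw [Real.sqrt_eq_rpow, one_div (_ ^ _), ← Real.rpow_neg h.le, Complex.ofReal_cpow h.le]
  push_cast
  rfl

/-- A holomorphic function is smooth, so restricting the complex integral to the real axis avoids
repeated differentiation under the integral. -/
theorem contDiffOn_ellK : ContDiffOn ℝ ∞ ellK (Ioo 0 1) := by
  have h1 : ContDiffOn ℂ ∞ complexEllK (Metric.ball 0 1) :=
    differentiableOn_complexEllK.contDiffOn Metric.isOpen_ball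
  have h2 : ContDiffOn ℝ ∞ (fun k : ℝ => (complexEllK k).re) (Ioo 0 1) := by
    have h3 : ContDiffOn ℝ ∞ (fun k : ℝ => complexEllK k) (Ioo 0 1) :=
      (h1.restrict_scalars ℝ).comp Complex.ofRealCLM.contDiff.contDiffOn fun k hk => by
        simpa [abs_of_pos hk.1] using hk.2
    exact Complex.reCLM.contDiff.comp_contDiffOn h3
  exact h2.congr fun k hk => by rw [complexEllK_ofReal hk, Complex.ofReal_re]

theorem contDiffOn_compl : ContDiffOn ℝ ∞ compl (Ioo 0 1) := by
  refine ContDiffOn.sqrt (by fun_prop) fun k hk => ?_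
  nlinarith [hk.1, hk.2]

theorem strictMonoOn_ellK : StrictMonoOn ellK (Ioo 0 1) := by
  intro a ha b hb hab
  have hp : (0 : ℝ) < Real.pi / 2 := by positivity
  have hab2 : a ^ 2 < b ^ 2 := by nlinarith [ha.1]
  refine intervalIntegral.integral_lt_integral_of_continuousOn_of_le_of_exists_lt hp
    (continuous_ellF_integrand ha).continuousOn (continuous_ellF_integrand hb).continuousOn ?_
    ⟨Real.pi / 2, ⟨hp.le, le_rfl⟩, ?_⟩
  · intro θ _
    refine one_div_le_one_div_of_le (Real.sqrt_pos.mpr (one_sub_sq_mul_sin_sq_pos hb θ)) ?_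
    exact Real.sqrt_le_sqrt (by nlinarith [sq_nonneg (Real.sin θ)])
  · refine one_div_lt_one_div_of_lt (Real.sqrt_pos.mpr (one_sub_sq_mul_sin_sq_pos hb _)) ?_
    refine Real.sqrt_lt_sqrt (one_sub_sq_mul_sin_sq_pos hb _).le ?_
    simp only [Real.sin_pi_div_two]
    linarith

theorem strictAntiOn_compl : StrictAntiOn compl (Ioo 0 1) := by
  intro a ha b hb hab
  refine Real.sqrt_lt_sqrt (by nlinarith [hb.1, hb.2]) ?_
  nlinarith [ha.1]

/-- 1 - k² sin²θ = cos²θ + k'² sin²θ ≤ (cos θ + k')² ≤ (π/2 - θ + k')², and the reciprocal of the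
last base integrates to the logarithm. Hence K is unbounded as k → 1. -/
theorem log_le_ellK {k : ℝ} (hk : k ∈ Ioo (0 : ℝ) 1) :
    Real.log (1 + Real.pi / (2 * compl k)) ≤ ellK k := by
  have hc := (compl_mem hk).1
  have hp : (0 : ℝ) < Real.pi / 2 := by positivity
  have hpos : ∀ θ ∈ Icc (0 : ℝ) (Real.pi / 2), 0 < Real.pi / 2 - θ + compl k := fun θ hθ => by
    linarith [hθ.2]
  have hcont : ContinuousOn (fun θ => 1 / (Real.pi / 2 - θ + compl k))
      (Icc (0 : ℝ) (Real.pi / 2)) :=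
    ContinuousOn.div continuousOn_const (Continuous.continuousOn (by fun_prop))
      fun θ hθ => (hpos θ hθ).ne'
  have h1 : ∫ θ in (0 : ℝ)..(Real.pi / 2), 1 / (Real.pi / 2 - θ + compl k) =
      Real.log (1 + Real.pi / (2 * compl k)) := by
    rw [intervalIntegral.integral_eq_sub_of_hasDerivAt
      (f := fun θ => -Real.log (Real.pi / 2 - θ + compl k)) (fun θ hθ => ?_)
      (ContinuousOn.intervalIntegrable (by rwa [uIcc_of_le hp.le]))]
    · simp only [sub_self, zero_add, sub_zero]
      rw [neg_sub_neg, ← Real.log_div (by positivity) hc.ne']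
      congr 1
      field_simp
      ring
    · rw [uIcc_of_le hp.le] at hθ
      have := ((((hasDerivAt_id θ).const_sub (Real.pi / 2)).add_const (compl k)).log
        (hpos θ hθ).ne').neg
      refine this.congr_deriv ?_
      simp only [id]
      ring
  rw [← h1]
  refine intervalIntegral.integral_mono_on hp.le
    (ContinuousOn.intervalIntegrable (by rwa [uIcc_of_le hp.le]))
    ((continuous_ellF_integrand hk).intervalIntegrable _ _) fun θ hθ => ?_
  refine one_div_le_one_div_of_le (Real.sqrt_pos.mpr (one_sub_sq_mul_sin_sq_pos hk θ)) ?_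
  have hcos : 0 ≤ Real.cos θ := Real.cos_nonneg_of_neg_pi_div_two_le_of_le (by linarith [hθ.1]) hθ.2
  have hle : Real.cos θ ≤ Real.pi / 2 - θ := by
    rw [← Real.sin_pi_div_two_sub]
    exact Real.sin_le (by linarith [hθ.2])
  rw [Real.sqrt_le_left (hpos θ hθ).le]
  have e : 1 - k ^ 2 * Real.sin θ ^ 2 ≤ (Real.cos θ + compl k) ^ 2 := by
    have e1 := Real.sin_sq_add_cos_sq θ
    have e2 := compl_sq hk
    nlinarith [mul_nonneg hcos hc.le, sq_nonneg (Real.cos θ), sq_nonneg (compl k)]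
  exact e.trans (pow_le_pow_left₀ (by positivity) (by linarith) 2)

theorem exists_lt_ellK (M : ℝ) : ∃ k ∈ Ioo (0 : ℝ) 1, M < ellK k := by
  -- Used as k', this makes the lower bound log(1 + π e^{|M|}), which exceeds M.
  have hc : Real.exp (-|M|) / 2 ∈ Ioo (0 : ℝ) 1 := by
    have : Real.exp (-|M|) ≤ 1 := Real.exp_le_one_iff.mpr (by simp)
    exact ⟨by positivity, by linarith⟩
  refine ⟨compl (Real.exp (-|M|) / 2), compl_mem hc, ?_⟩
  refine lt_of_lt_of_le ?_ (log_le_ellK (compl_mem hc))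
  rw [compl_compl hc, Real.lt_log_iff_exp_lt (by positivity)]
  have h1 : Real.pi / (2 * (Real.exp (-|M|) / 2)) = Real.pi * Real.exp |M| := by
    rw [Real.exp_neg]
    field_simp
  have h2 : Real.exp M ≤ Real.exp |M| := Real.exp_le_exp.mpr (le_abs_self M)
  rw [h1]
  nlinarith [Real.pi_gt_three, Real.exp_pos |M|]

/-! ### The threshold modulus. -/

variable {L δ : ℝ}

theorem strictMonoOn_vRatio (hL : 0 < L) (hδ : 0 < δ) :
    StrictMonoOn (vRatio L δ) (Ioo 0 1) := by
  intro a ha b hb hab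
  have h1 := strictMonoOn_ellK ha hb hab
  have h2 := strictMonoOn_ellK (compl_mem hb) (compl_mem ha) (strictAntiOn_compl ha hb hab)
  have h3 := ellK_pos hb
  have h4 := ellK_pos (compl_mem hb)
  simp only [vRatio]
  gcongr

theorem continuousOn_vRatio : ContinuousOn (vRatio L δ) (Ioo 0 1) :=
  continuousOn_const.mul (contDiffOn_ellK.continuousOn.div
    (contDiffOn_ellK.continuousOn.comp contDiffOn_compl.continuousOn fun _ => compl_mem)
    fun _ hk => (ellK_pos (compl_mem hk)).ne')

theorem exists_vRatio_eq_one (hL : 0 < L) (hδ : 0 < δ) :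
    ∃ k ∈ Ioo (0 : ℝ) 1, vRatio L δ k = 1 := by
  have hh : (1 / 2 : ℝ) ∈ Ioo (0 : ℝ) 1 := by norm_num
  have hm := strictMonoOn_ellK.monotoneOn
  have ha := strictAntiOn_compl.antitoneOn
  obtain ⟨b, hb, hMb⟩ := exists_lt_ellK (2 * δ / L * ellK (1 / 2))
  obtain ⟨c, hc, hMc⟩ := exists_lt_ellK (L / (2 * δ) * ellK (compl (1 / 2)))
  have h1 : min (1 / 2) (compl b) ∈ Ioo (0 : ℝ) 1 :=
    ⟨lt_min hh.1 (compl_mem hb).1, (min_le_left _ _).trans_lt hh.2⟩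
  have h2 : max (1 / 2) c ∈ Ioo (0 : ℝ) 1 := ⟨hh.1.trans_le (le_max_left _ _), max_lt hh.2 hc.2⟩
  -- The bound 1/2 controls the numerator while the bound k'(b) makes the denominator at least K(b).
  -- At the other end the roles are exchanged.
  have h3 : vRatio L δ (min (1 / 2) (compl b)) ≤ 1 := by
    have e1 := hm h1 hh (min_le_left _ _)
    have e2 := ha h1 (compl_mem hb) (min_le_right _ _)
    rw [compl_compl hb] at e2
    have e3 := hm hb (compl_mem h1) e2
    have e4 := ellK_pos (compl_mem h1)
    rw [vRatio, mul_div_assoc', div_le_one e4]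
    have : 2 * δ / L * ellK (min (1 / 2) (compl b)) ≤ 2 * δ / L * ellK (1 / 2) := by gcongr
    linarith
  have h4 : 1 ≤ vRatio L δ (max (1 / 2) c) := by
    have e1 := hm hc h2 (le_max_right _ _)
    have e2 := ha hh h2 (le_max_left _ _)
    have e3 := hm (compl_mem h2) (compl_mem hh) e2
    have e4 := ellK_pos (compl_mem h2)
    rw [vRatio, mul_div_assoc', one_le_div e4]
    have : L / (2 * δ) * ellK (compl (1 / 2)) ≤ ellK (max (1 / 2) c) := hMc.le.trans e1
    calc ellK (compl (max (1 / 2) c)) ≤ ellK (compl (1 / 2)) := e3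
      _ = 2 * δ / L * (L / (2 * δ) * ellK (compl (1 / 2))) := by field_simp
      _ ≤ _ := by gcongr
  exact isPreconnected_Ioo.intermediate_value h1 h2 continuousOn_vRatio ⟨h3, h4⟩

end Modulus

/-! ### The smooth curve of profiles -/

section Curve

open Filter Topology

/-- The Sobolev weight `(1 + m²)^(n/2)`. -/
def weight (n : ℕ) (m : ℤ) : ℝ := √(1 + (m : ℝ) ^ 2) ^ n

theorem one_le_weight (n : ℕ) (m : ℤ) : 1 ≤ weight n m :=
  one_le_pow₀ (Real.one_le_sqrt.mpr (by nlinarith [sq_nonneg (m : ℝ)]))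

theorem weight_le (n : ℕ) (m : ℤ) : weight n m ≤ (1 + |(m : ℝ)|) ^ n := by
  refine pow_le_pow_left₀ (Real.sqrt_nonneg _) ?_ n
  rw [Real.sqrt_le_left (by positivity)]
  nlinarith [abs_nonneg (m : ℝ), sq_abs (m : ℝ)]

/-- Division of a sequence by the Sobolev weight, with removal of the `0`-th term. -/
def divWeight (n : ℕ) :
    lp (fun _ : ℤ => ℂ) 2 →ₗ[ℂ] lp (fun _ : ℤ => ℂ) 2 where
  toFun b := ⟨fun m => if m = 0 then 0 else b m / weight n m, (lp.memℓp b).mono' fun m => by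
    split_ifs
    · simp
    · rw [norm_div, Complex.norm_real, Real.norm_eq_abs]
      exact div_le_self (norm_nonneg _) ((one_le_weight n m).trans (le_abs_self _))⟩
  map_add' b c := by
    ext m
    simp only [lp.coeFn_add, Pi.add_apply]
    split_ifs
    · simp
    · ring
  map_smul' a b := by
    ext m
    simp only [lp.coeFn_smul, Pi.smul_apply, RingHom.id_apply, smul_eq_mul]
    split_ifs
    · simp
    · ring

variable {L : ℝ} [Fact (0 < L)]

/-- The `L²` function with Fourier coefficients `b_m / (1 + m²)^(n/2)` for `m ≠ 0` and mean `0`. -/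
def seqToL2 (L : ℝ) [Fact (0 < L)] (n : ℕ) : lp (fun _ : ℤ => ℂ) 2 →ₗ[ℂ] PerL2 L :=
  (fourierBasis (T := L)).repr.symm.toLinearEquiv.toLinearMap ∘ₗ divWeight n

theorem fourierCoeff_seqToL2 (n : ℕ) (b : lp (fun _ : ℤ => ℂ) 2) (m : ℤ) :
    fourierCoeff (seqToL2 L n b) m = if m = 0 then 0 else b m / weight n m := by
  rw [← fourierBasis_repr]
  simp [seqToL2, divWeight]

theorem norm_weightedCoeff_seqToL2_le (n : ℕ) (b : lp (fun _ : ℤ => ℂ) 2) (m : ℤ) :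
    ‖weightedCoeff L n (seqToL2 L n b) m‖ ≤ ‖b m‖ := by
  have h : weightedCoeff L n (seqToL2 L n b) m =
      (weight n m : ℂ) * fourierCoeff (seqToL2 L n b) m := rfl
  have hw : (weight n m : ℂ) ≠ 0 := by
    exact_mod_cast (zero_lt_one.trans_le (one_le_weight n m)).ne'
  rw [h, fourierCoeff_seqToL2]
  split_ifs
  · simp
  · rw [mul_div_cancel₀ _ hw]

theorem seqToL2_mem_H0 (n : ℕ) (b : lp (fun _ : ℤ => ℂ) 2) : seqToL2 L n b ∈ H0 L := by
  have h := fourierCoeff_seqToL2 (L := L) n b 0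
  rw [if_pos rfl, fourierCoeff] at h
  change ∫ x : AddCircle L, seqToL2 L n b x = 0
  rw [volume_eq_smul_haarAddCircle, integral_smul_measure]
  simp only [neg_zero, fourier_zero, one_smul] at h
  rw [h, smul_zero]

/-- `seqToL2` as a bounded operator into `H^n_per ∩ H₀`. -/
def seqToHPerZero (L : ℝ) [Fact (0 < L)] (n : ℕ) :
    lp (fun _ : ℤ => ℂ) 2 →L[ℂ] HPerZero L n :=
  LinearMap.mkContinuous
    (LinearMap.codRestrict (HPerZero L n)
      (show lp (fun _ : ℤ => ℂ) 2 →ₗ[ℂ] HPer L n from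
        LinearMap.codRestrict (sobolevSubmodule L n) (seqToL2 L n) fun b =>
          (lp.memℓp b).mono' (norm_weightedCoeff_seqToL2_le n b))
      fun b => seqToL2_mem_H0 n b) 1 fun b => by
    rw [one_mul]
    exact lp.norm_mono two_ne_zero (norm_weightedCoeff_seqToL2_le n b)

theorem toL2_seqToHPerZero (n : ℕ) (b : lp (fun _ : ℤ => ℂ) 2) :
    HPer.toL2 L n (seqToHPerZero L n b) = seqToL2 L n b := rfl

/-- The weighted Fourier coefficients of the profile as a function of a complexified
`ρ = πK(k')/K(k)`. -/
def curveTerm (c d : ℝ) (n : ℕ) (z : ℂ) (m : ℤ) : ℂ :=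
  if m = 0 then 0 else weight n m * (c * (Real.sinh (m * d) / Complex.sinh (m * z)))

/-- The sequence `curveTerm` as an element of `ℓ²`. -/
def curveSeq (c d : ℝ) (n : ℕ) (z : ℂ) : lp (fun _ : ℤ => ℂ) 2 :=
  ∑' m : ℤ, lp.single 2 m (curveTerm c d n z m)

theorem norm_curveTerm_le (c : ℝ) {d r : ℝ} (n : ℕ) (hd : 0 < d) (hr : 0 < r) {z : ℂ}
    (hz : r ≤ z.re) (m : ℤ) :
    ‖curveTerm c d n z m‖ ≤ |c| * (2 / (1 - Real.exp (-(2 * r)))) *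
      ((1 + |(m : ℝ)|) ^ n * Real.exp (-(|(m : ℝ)| * (r - d)))) := by
  have he : 0 < 1 - Real.exp (-(2 * r)) := by
    have : Real.exp (-(2 * r)) < 1 := Real.exp_lt_one_iff.mpr (by linarith)
    linarith
  rw [curveTerm]
  split_ifs with hm
  · rw [norm_zero]
    positivity
  · have h1 := cosh_div_norm_sinh_le hd hr hm hz
    have h2 : ‖(Real.sinh (m * d) : ℂ) / Complex.sinh (m * z)‖ ≤
        2 / (1 - Real.exp (-(2 * r))) * Real.exp (-(|(m : ℝ)| * (r - d))) := by
      rw [norm_div, Complex.norm_real, Real.norm_eq_abs]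
      refine le_trans ?_ h1
      gcongr
      exact abs_sinh_le_cosh _
    rw [norm_mul, norm_mul, Complex.norm_real, Complex.norm_real, Real.norm_eq_abs,
      Real.norm_eq_abs, abs_of_pos (zero_lt_one.trans_le (one_le_weight n m))]
    calc _ ≤ (1 + |(m : ℝ)|) ^ n * (|c| * (2 / (1 - Real.exp (-(2 * r))) *
          Real.exp (-(|(m : ℝ)| * (r - d))))) := by
          gcongr
          exact weight_le n m
      _ = _ := by ring

/-- For Re z > d the series of one-term sequences converges in ℓ², so the continuous evaluation at m
passes through the sum. -/
theorem curveSeq_apply (c : ℝ) {d : ℝ} (n : ℕ) (hd : 0 < d) {z : ℂ} (hz : d < z.re) (m : ℤ) :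
    curveSeq c d n z m = curveTerm c d n z m := by
  have hs : Summable fun m : ℤ => lp.single (E := fun _ : ℤ => ℂ) 2 m (curveTerm c d n z m) := by
    refine Summable.of_norm_bounded ((summable_pow_mul_exp_neg_abs n (sub_pos.mpr hz)).mul_left
      (|c| * (2 / (1 - Real.exp (-(2 * z.re)))))) fun m => ?_
    rw [lp.norm_single (by norm_num)]
    exact norm_curveTerm_le c n hd (hd.trans hz) le_rfl m
  have h := (lp.evalCLM ℂ (fun _ : ℤ => ℂ) 2 m).hasSum hs.hasSum
  have h2 : HasSum (fun i : ℤ => lp.single (E := fun _ : ℤ => ℂ) 2 i (curveTerm c d n z i) m)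
      (curveTerm c d n z m) := by
    have := hasSum_single (f := fun i : ℤ => lp.single (E := fun _ : ℤ => ℂ) 2 i
      (curveTerm c d n z i) m) m fun i hi => lp.single_apply_ne 2 i _ hi.symm
    rwa [lp.single_apply_self] at this
  exact h.unique h2

/-! ### Holomorphic dependence of the coefficient sequence on ρ. -/

theorem sinh_int_mul_ne_zero {z : ℂ} (hz : 0 < z.re) {m : ℤ} (hm : m ≠ 0) :
    Complex.sinh (m * z) ≠ 0 := by
  have h1 := sinh_abs_re_le_norm_sinh (m * z)
  have h2 : ((m : ℂ) * z).re = m * z.re := by simp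
  have h3 : (m : ℝ) ≠ 0 := by exact_mod_cast hm
  have h4 : 0 < Real.sinh |((m : ℂ) * z).re| := by
    rw [Real.sinh_pos_iff, h2]
    positivity
  exact norm_pos_iff.mp (h4.trans_le h1)

/-- Weierstrass's theorem on each half-plane Re w > r with r > d: the terms are holomorphic, and the
exponential bound is uniform there but not up to Re w = d. -/
theorem differentiableOn_curveSeq (c : ℝ) {d : ℝ} (n : ℕ) (hd : 0 < d) :
    DifferentiableOn ℂ (curveSeq c d n) {z | d < z.re} := by
  intro z hz
  obtain ⟨r, hdr, hrz⟩ := exists_between (show d < z.re from hz)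
  have hr := hd.trans hdr
  have hU : IsOpen {w : ℂ | r < w.re} := isOpen_lt continuous_const Complex.continuous_re
  have h : DifferentiableOn ℂ (curveSeq c d n) {w | r < w.re} := by
    refine Complex.differentiableOn_tsum_of_summable_norm
      ((summable_pow_mul_exp_neg_abs n (sub_pos.mpr hdr)).mul_left
        (|c| * (2 / (1 - Real.exp (-(2 * r)))))) ?_ hU ?_
    · intro m
      have h1 : DifferentiableOn ℂ (fun w => curveTerm c d n w m) {w | r < w.re} := by
        unfold curveTerm
        split_ifs with hm
        · exact differentiableOn_const _
        · intro w hw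
          have := sinh_int_mul_ne_zero (hr.trans hw) hm
          refine DifferentiableAt.differentiableWithinAt ?_
          have h2 : DifferentiableAt ℂ (fun w : ℂ => Complex.sinh (m * w)) w := by fun_prop
          exact (((differentiableAt_const _).div h2 this).const_mul _).const_mul _
      exact (lp.singleContinuousLinearMap ℂ
        (fun _ : ℤ => ℂ) 2 m).differentiable.comp_differentiableOn h1
    · intro m w hw
      rw [lp.norm_single (by norm_num)]
      exact norm_curveTerm_le c n hd hr hw.le m
  exact (h.differentiableAt (hU.mem_nhds hrz)).differentiableWithinAt

/-- The line is a countable union of periods, each mapped to the circle preserving measure. -/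
theorem ae_coe_addCircle {p : AddCircle L → Prop} (h : ∀ᵐ x ∂(haarAddCircle (T := L)), p x) :
    ∀ᵐ x : ℝ, p x := by
  have hL : 0 < L := Fact.out
  have hv : ∀ᵐ x : AddCircle L, p x := by
    rw [volume_eq_smul_haarAddCircle]
    exact h.filter_mono (Measure.ae_smul_measure_le _)
  have h1 : ∀ n : ℤ, ∀ᵐ x : ℝ ∂(volume.restrict (Ioc (n • L) ((n + 1) • L))),
      p (x : AddCircle L) := by
    intro n
    have := (AddCircle.measurePreserving_mk L (n • L)).quasiMeasurePreserving.ae hv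
    rwa [show n • L + L = (n + 1) • L by rw [add_smul, one_smul]] at this
  have h2 := ae_restrict_iUnion_iff (μ := volume) (fun n : ℤ => Ioc (n • L) ((n + 1) • L))
    (fun x : ℝ => p (x : AddCircle L))
  rw [iUnion_Ioc_zsmul hL, Measure.restrict_univ] at h2
  exact h2.mpr h1

theorem eq_toLp_of_fourierCoeff {f : PerL2 L} {g : C(AddCircle L, ℂ)}
    (h : ∀ m, fourierCoeff f m = fourierCoeff g m) :
    f = ContinuousMap.toLp (E := ℂ) 2 haarAddCircle ℂ g := by
  apply (fourierBasis (T := L)).repr.injective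
  ext m
  rw [fourierBasis_repr, fourierBasis_repr, fourierCoeff_toLp, h]

/-- The curve is a bounded linear map after a holomorphic ℓ²-valued map after the smooth function
ρ(k) = πK(k')/K(k). Its Fourier coefficients match those of the profile, so the two agree almost
everywhere. -/
theorem exists_contDiffOn_curve {δ : ℝ} (hδ : 0 < δ) (n : ℕ) {s : Set ℝ} (hs : s ⊆ Ioo 0 1)
    (hv : ∀ k ∈ s, vRatio L δ k < 1) :
    ∃ Φ : ℝ → HPerZero L n, ContDiffOn ℝ ∞ Φ s ∧ ∀ k ∈ s, ∀ᵐ x : ℝ,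
      (HPer.toL2 L n (Φ k) : AddCircle L → ℂ) (x : AddCircle L) = profile L δ k x := by
  have hL : 0 < L := Fact.out
  set d := 2 * Real.pi * δ / L with hd_def
  set c := 2 * Real.pi / L with hc_def
  have hd : 0 < d := by positivity
  have hU : IsOpen {z : ℂ | d < z.re} := isOpen_lt continuous_const Complex.continuous_re
  have hmaps : ∀ k ∈ s, d < ((Real.pi * ellK (compl k) / ellK k : ℝ) : ℂ).re := fun k hk =>
    lt_of_vRatio_lt_one hL (hs hk) (hv k hk)
  refine ⟨fun k => seqToHPerZero L n (curveSeq c d n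
    ((Real.pi * ellK (compl k) / ellK k : ℝ) : ℂ)), ?_, fun k hk => ?_⟩
  · have h1 : ContDiffOn ℝ ∞ (fun k => Real.pi * ellK (compl k) / ellK k) s :=
      ((contDiffOn_const.mul (contDiffOn_ellK.comp contDiffOn_compl fun _ => compl_mem)).div
        contDiffOn_ellK fun k hk => (ellK_pos hk).ne').mono hs
    have h2 : ContDiffOn ℝ ∞ (fun k => ((Real.pi * ellK (compl k) / ellK k : ℝ) : ℂ)) s :=
      Complex.ofRealCLM.contDiff.comp_contDiffOn h1
    have h3 : ContDiffOn ℂ ∞ (curveSeq c d n) {z | d < z.re} :=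
      (differentiableOn_curveSeq c n hd).contDiffOn hU
    have h4 : ContDiffOn ℂ ∞ (fun z => seqToHPerZero L n (curveSeq c d n z)) {z | d < z.re} :=
      (seqToHPerZero L n).contDiff.comp_contDiffOn h3
    exact (h4.restrict_scalars ℝ).comp h2 hmaps
  · have hp := profile_periodic (δ := δ) hL (hs hk)
    set g : C(AddCircle L, ℂ) :=
      ⟨hp.lift, continuous_lift (continuous_profile hL hδ (hs hk) (hv k hk)) hp⟩ with hg
    have hcoeff : ∀ m, fourierCoeff (seqToL2 L n (curveSeq c d n
        ((Real.pi * ellK (compl k) / ellK k : ℝ) : ℂ))) m = fourierCoeff g m := fun m => by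
      have hw : (weight n m : ℂ) ≠ 0 := by
        exact_mod_cast (zero_lt_one.trans_le (one_le_weight n m)).ne'
      have e : fourierCoeff g m = coeff L (profile L δ k) m := fourierCoeff_lift hp m
      rw [e, coeff_profile hL hδ (hs hk) (hv k hk), fourierCoeff_seqToL2,
        curveSeq_apply c n hd (hmaps k hk), curveTerm]
      split_ifs
      · simp
      · rw [mul_div_cancel_left₀ _ hw]
        rw [hc_def, hd_def]
        push_cast
        rfl
    have h1 := ae_coe_addCircle (ContinuousMap.coeFn_toLp (E := ℂ) (p := 2) (𝕜 := ℂ)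
      (haarAddCircle (T := L)) g)
    rw [← eq_toLp_of_fourierCoeff hcoeff] at h1
    filter_upwards [h1] with x hx
    rw [toL2_seqToHPerZero, hx, hg, ContinuousMap.coe_mk, Function.Periodic.lift_coe]

end Curve

end ILW

end

/-! ### Choice of k₁ and conclusion. -/

theorem theorem3p1 (L δ : ℝ) [Fact (0 < L)] (hδ : 0 < δ) :
    ∃ k₁ ∈ Set.Ioo (0 : ℝ) 1,
      (∀ k ∈ Set.Ioo (0 : ℝ) 1, ILW.vRatio L δ k < 1 ↔ k < k₁) ∧
      -- the smooth curve `k ↦ φ_{c(k)}` into `H^n_per([0,L]) ∩ H₀`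
      (∀ n : ℕ, ∃ Φ : ℝ → ILW.HPerZero L n,
        ContDiffOn ℝ ∞ Φ (Set.Ioo 0 k₁) ∧
        ∀ k ∈ Set.Ioo 0 k₁, ∀ᵐ x : ℝ,
          (ILW.HPer.toL2 L n (Φ k) : AddCircle L → ℂ) (x : AddCircle L)
            = ILW.profile L δ k x) ∧
      ∀ k ∈ Set.Ioo 0 k₁,
        -- the profile is real-valued, `L`-periodic and even
        (∀ x, (ILW.profile L δ k x).im = 0) ∧
        Function.Periodic (ILW.profile L δ k) L ∧
        Function.Even (ILW.profile L δ k) ∧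
        -- the travelling wave equation, with `A(k) = (1/L) ∫₀^L φ_k²`
        ∀ x, Summable (ILW.dispersionTerm L δ (ILW.profile L δ k) x) ∧
          -(ILW.speed L δ k : ℂ) * ILW.profile L δ k x + ILW.profile L δ k x ^ 2
              - ILW.dispersion L δ (ILW.profile L δ k) x
            = 1 / (L : ℂ) * ∫ y in (0 : ℝ)..L, ILW.profile L δ k y ^ 2 := by
  have hL : 0 < L := Fact.out
  obtain ⟨k₁, hk₁, h1⟩ := ILW.exists_vRatio_eq_one hL hδ
  have hiff : ∀ k ∈ Set.Ioo (0 : ℝ) 1, ILW.vRatio L δ k < 1 ↔ k < k₁ := fun k hk => by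
    rw [← h1]
    exact (ILW.strictMonoOn_vRatio hL hδ).lt_iff_lt hk hk₁
  have hsub : Set.Ioo 0 k₁ ⊆ Set.Ioo (0 : ℝ) 1 := Set.Ioo_subset_Ioo_right hk₁.2.le
  have hv : ∀ k ∈ Set.Ioo 0 k₁, ILW.vRatio L δ k < 1 := fun k hk => (hiff k (hsub hk)).mpr hk.2
  refine ⟨k₁, hk₁, hiff, fun n => ILW.exists_contDiffOn_curve hδ n hsub hv, fun k hk =>
    ⟨fun x => ?_, ILW.profile_periodic hL (hsub hk), ILW.profile_even (hsub hk), fun x =>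
      ⟨(ILW.hasSum_dispersionTerm hL hδ (hsub hk) (hv k hk) x).summable,
        ILW.wave_equation hL hδ (hsub hk) (hv k hk) x⟩⟩⟩
  rw [ILW.profile_eq (hsub hk), Complex.ofReal_im]
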